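/- **Setting.** Let $\mathcal G$ be a connected graph on $\{1,\dots,n\}$, let $d\ge 1$, and let $\hat W\in\mathbb R^{n\times n}$ be symmetric positive semidefinite with $\operatorname{Ker}\hat W=\operatorname{span}\{(1,\dots,1)^\top\}$ and $\hat W_{ij}\neq 0$ if and only if $i=j$ or $(i,j)$ is an edge. Put $W=\hat W\otimes I_d$ and $\chi=\lambda_{\max}(W)/\lambda^+_{\min}(W)$, where $\lambda^+_{\min}$ is the smallest positive eigenvalue. Let $f_1,\dots,f_n:\mathbb R^d\to\mathbb R$ be differentiable, and let $P(\mathbf x)=\sum_{i=1}^n f_i(x_i)$ on $\mathbb R^{nd}$ be $\mu$-strongly convex ($\mu>0$) with $L$-Lipschitz gradient; $\kappa=L/\mu$. **Accelerated gossip.** $\mathrm{AG}(W,\mathbf x,N)=\mathbf x-\mathbf x_N/a_N$, where $a_0=1$, $a_1=c_2$, $\mathbf x_0=\mathbf x$, $\mathbf x_1=c_2(I-c_3W)\mathbf x$, and $a_{i+1}=2c_2a_i-a_{i-1}$, $\mathbf x_{i+1}=2c_2(I-c_3W)\mathbf x_i-\mathbf x_{i-1}$. Here $$N=\lfloor\sqrt\chi\rfloor,\quad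 c_1=\frac{\sqrt\chi-1}{\sqrt\chi+1},\quad c_2=\frac{\chi+1}{\chi-1},\quad c_3=\frac{2\chi}{(1+\chi)\lambda_{\max}(W)}$$ (if $\chi=1$, then $N=1$, $\mathrm{AG}(W,\mathbf x,1)=c_3W\mathbf x$ for every $c_2\ne0$, and we take $c_2=1$). Write $K\mathbf x=\mathrm{AG}(W,\mathbf x,N)$; this is a symmetric linear map. **Inner method $\mathcal M$**, applied to a convex $\ell$-smooth function $\Psi$; one of the following. - GD: step size $1/\ell$; $\alpha=2$, $A=4$. - FGD+GD: the first $\lfloor T/2\rfloor$ of the $T$ iterations are Nesterov's fast gradient descent ($x_{k+1}=y_k-\nabla\Psi(y_k)/\ell$, $t_{k+1}=(1+\sqrt{1+4t_k^2})/2$, $y_{k+1}=x_{k+1}+\frac{t_k-1}{t_{k+1}}(x_{k+1}-x_k)$, $t_0=1$, $y_0=x_0$), the remaining ones are GD; $\alpha=3$, $A=64$. - FGD+FSFOM: the first $\lfloor T/2\rfloor$ iterations are FGD, the remaining $m=T-\lfloor T/2\rfloor$ are the fixed-step first-order method of Kim and Fessler (OGM-G): with $\vartheta_m=1$, $\vartheta_i=(1+\sqrt{1+4\vartheta_{i+1}^2})/2$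 for $0<i<m$, $\vartheta_0=(1+\sqrt{1+8\vartheta_1^2})/2$ and $y_0=x_0$, it computes $y_{i+1}=x_i-\nabla\Psi(x_i)/\ell$ and $x_{i+1}=y_{i+1}+\frac{(\vartheta_i-1)(2\vartheta_{i+1}-1)}{\vartheta_i(2\vartheta_i-1)}(y_{i+1}-y_i)+\frac{2\vartheta_{i+1}-1}{2\vartheta_i-1}(y_{i+1}-x_i)$; $\alpha=4$, $A=256$. **Parameters.** $\lambda_1=1+\frac{2c_1^N}{1+c_1^{2N}}$, $\lambda_2=1-\frac{2c_1^N}{1+c_1^{2N}}$, $$\eta_x=\frac{1}{2\sqrt{L\mu}}\frac{\lambda_2}{\lambda_1},\quad \eta_y=\frac{\sqrt{L\mu}}{\sqrt2\,\lambda_1\lambda_2},\quad \beta_y=\min\Big\{\frac1L,\frac1{2\lambda_1^2\eta_y}\Big\},\quad \theta=\max\Big\{\frac{2}{2+\mu\eta_x},\,1-\lambda_2^2\beta_y\eta_y\Big\},$$ $$T=\Big\lceil (20A)^{1/\alpha}\big(1+\sqrt{L/\mu}\big)^{2/\alpha}\Big\rceil .$$ **Algorithm** (APDA with inexact prox and accelerated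 gossip). From any $\mathbf x^0,\mathbf y^0\in\mathbb R^{nd}$, with $\bar{\mathbf y}^0=\mathbf y^0$, for $k=0,1,\dots$: let $\Psi^k(\mathbf x)=P(\mathbf x)+\frac1{2\eta_x}\|\mathbf x-(\mathbf x^k-\eta_xK\bar{\mathbf y}^k)\|^2$; let $\hat{\mathbf x}^k$ be the output of $T$ iterations of $\mathcal M$ on $\Psi^k$ started at $\mathbf x^k$ (with $\ell=L+1/\eta_x$); and set $$\mathbf x^{k+1}=\mathbf x^k-\eta_x(\nabla P(\hat{\mathbf x}^k)+K\bar{\mathbf y}^k),\quad \mathbf y^{k+1}=\mathbf y^k+\eta_y\big(K\hat{\mathbf x}^k-\beta_yK(K\mathbf y^k+\nabla P(\hat{\mathbf x}^k))\big),\quad \bar{\mathbf y}^{k+1}=\mathbf y^{k+1}+\theta(\mathbf y^{k+1}-\mathbf y^k).$$ Every multiplication by $W$ is one communication round and every evaluation of $\nabla P$ is one gradient computation. **Lyapunov function.** Let $(\mathbf x^\star,\mathbf y^\star)$ be a solution of $\min_{\mathbf x}\max_{\mathbf y}\{P(\mathbf x)+\langle\mathbf y,K\mathbf x\rangle\}$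 with $\mathbf y^\star-\mathbf y^0\in\operatorname{range}W$, and let $w^{\star k}=\arg\min\Psi^k$. Put $\Delta^0=(1+\frac{\mu\eta_x}2)\frac1{\eta_x}\|\mathbf x^0-\mathbf x^\star\|^2+\frac1{\eta_y}\|\mathbf y^0-\mathbf y^\star\|^2$ and $$\Delta^{k+1}=\Big(1+\frac{\mu\eta_x}2\Big)\frac1{\eta_x}\|\mathbf x^{k+1}-\mathbf x^\star\|^2+\frac1{\eta_y}\|\mathbf y^{k+1}-\mathbf y^\star\|^2+\frac1{2\eta_y}\|\mathbf y^{k+1}-\mathbf y^k\|^2+\frac1{8\eta_x}\|\mathbf x^k-w^{\star k}\|^2-2\langle K\mathbf y^{k+1}-K\mathbf y^k,\hat{\mathbf x}^k-\mathbf x^\star\rangle .$$ **Theorem.** There is a universal constant $C>0$ such that, in this setting, for each of the three inner methods: 1. $0\le\Delta^k\le\theta^k\Delta^0$ for all $k\ge0$. 2. The number of local steps per iteration satisfies $T\le C\kappa^{1/\alpha}$, i.e. it is $O(\kappa^{1/2})$, $O(\kappa^{1/3})$, $O(\kappa^{1/4})$ for GD, FGD+GD and FGD+FSFOM respectively. 3.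 For every $\varepsilon>0$ there is a $k$ with $\Delta^k\le\varepsilon\Delta^0$ such that the first $k$ iterations use at most $C\kappa^{\frac{2+\alpha}{2\alpha}}\max\{1,\log(1/\varepsilon)\}$ gradient computations and at most $C\sqrt{\kappa\chi}\,\max\{1,\log(1/\varepsilon)\}$ communication rounds. -/

import Mathlib

noncomputable section

namespace Decentralized

/-! ### Counting oracle calls -/

/-- The result of a computation together with the number of evaluations of `∇P` and the number of
communication rounds (multiplications of a stacked vector by the gossip matrix) it used. -/
structure Counted (α : Type) : Type where
  val : α
  grads : ℕ
  comms : ℕ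

instance : Monad Counted where
  pure a := ⟨a, 0, 0⟩
  bind m f := ⟨(f m.val).val, m.grads + (f m.val).grads, m.comms + (f m.val).comms⟩

/-! ### The decentralized problem -/

/-- Stacked vectors `𝐱 = (x₁, …, xₙ)`, `xᵢ ∈ ℝᵈ`, with the Euclidean norm of `ℝⁿᵈ`. -/
abbrev Vec (n d : ℕ) : Type := EuclideanSpace ℝ (Fin n × Fin d)

/-- The block `xᵢ ∈ ℝᵈ` of a stacked vector. -/
def block {n d : ℕ} (x : Vec n d) (i : Fin n) : EuclideanSpace ℝ (Fin d) :=
  WithLp.toLp 2 fun j => x (i, j)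

/-- `P(𝐱) = ∑ᵢ fᵢ(xᵢ)`. -/
def stackedObjective {n d : ℕ} (f : Fin n → EuclideanSpace ℝ (Fin d) → ℝ) (x : Vec n d) : ℝ :=
  ∑ i, f i (block x i)

/-- `P` is `μ`-strongly convex (for differentiable `P`). -/
def IsStronglyConvex {n d : ℕ} (μ : ℝ) (P : Vec n d → ℝ) : Prop :=
  ∀ x x' : Vec n d, μ / 2 * ‖x - x'‖ ^ 2 ≤ P x - P x' - inner ℝ (gradient P x') (x - x')

/-- `P` is `L`-smooth (for differentiable `P`). -/
def IsLSmooth {n d : ℕ} (L : ℝ) (P : Vec n d → ℝ) : Prop :=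
  ∀ x x' : Vec n d, ‖gradient P x - gradient P x'‖ ≤ L * ‖x - x'‖

/-- `Ŵ` is a gossip matrix of the graph `G`. -/
structure IsGossipMatrix {n : ℕ} (G : SimpleGraph (Fin n)) (What : Matrix (Fin n) (Fin n) ℝ) :
    Prop where
  isSymm : What.IsSymm
  posSemidef : What.PosSemidef
  ker_eq : LinearMap.ker What.mulVecLin = Submodule.span ℝ {(fun _ => 1 : Fin n → ℝ)}
  support : ∀ i j, What i j ≠ 0 ↔ i = j ∨ G.Adj i j

/-- `W = Ŵ ⊗ I_d`. -/
def stackedGossip {n : ℕ} (d : ℕ) (What : Matrix (Fin n) (Fin n) ℝ) :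
    Matrix (Fin n × Fin d) (Fin n × Fin d) ℝ :=
  Matrix.kronecker What (1 : Matrix (Fin d) (Fin d) ℝ)

/-- The largest eigenvalue of a symmetric matrix. -/
def lambdaMax {ι : Type} [Fintype ι] [DecidableEq ι] (W : Matrix ι ι ℝ) : ℝ :=
  sSup (spectrum ℝ W)

/-- The smallest positive eigenvalue of a symmetric matrix. -/
def lambdaMinPos {ι : Type} [Fintype ι] [DecidableEq ι] (W : Matrix ι ι ℝ) : ℝ :=
  sInf {r | r ∈ spectrum ℝ W ∧ 0 < r}

/-- `χ = λ_max(W) / λ⁺_min(W)`. -/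
def chi {ι : Type} [Fintype ι] [DecidableEq ι] (W : Matrix ι ι ℝ) : ℝ :=
  lambdaMax W / lambdaMinPos W

/-- One evaluation of `∇P`. -/
def gradOracle {n d : ℕ} (P : Vec n d → ℝ) (x : Vec n d) : Counted (Vec n d) :=
  ⟨gradient P x, 1, 0⟩

/-- One communication round: multiplication by `W`. -/
def gossip {n d : ℕ} (W : Matrix (Fin n × Fin d) (Fin n × Fin d) ℝ) (x : Vec n d) :
    Counted (Vec n d) :=
  ⟨Matrix.toEuclideanLin W x, 0, 1⟩

/-! ### Accelerated (Chebyshev) gossip -/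

/-- The quantities `a_{i-1}, a_i, x_{i-1}, x_i` of the Chebyshev recursion. -/
structure ChebState (n d : ℕ) : Type where
  aPrev : ℝ
  a : ℝ
  xPrev : Vec n d
  x : Vec n d

/-- `chebLoop W c₂ c₃ x m` holds `a_m, a_{m+1}, x_m, x_{m+1}`, where `a₀ = 1`, `a₁ = c₂`, `x₀ = x`,
`x₁ = c₂ (I - c₃ W) x`, `a_{i+1} = 2 c₂ a_i - a_{i-1}` and
`x_{i+1} = 2 c₂ (I - c₃ W) x_i - x_{i-1}`. -/
def chebLoop {n d : ℕ} (W : Matrix (Fin n × Fin d) (Fin n × Fin d) ℝ) (c₂ c₃ : ℝ) (x : Vec n d) :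
    ℕ → Counted (ChebState n d)
  | 0 => do
      let wx ← gossip W x
      pure { aPrev := 1, a := c₂, xPrev := x, x := c₂ • (x - c₃ • wx) }
  | m + 1 => do
      let s ← chebLoop W c₂ c₃ x m
      let wx ← gossip W s.x
      pure { aPrev := s.a, a := 2 * c₂ * s.a - s.aPrev,
             xPrev := s.x, x := (2 * c₂) • (s.x - c₃ • wx) - s.xPrev }

/-- The procedure `AG(W, x, N)`, which returns `x - x_N / a_N`. -/
def accGossip {n d : ℕ} (W : Matrix (Fin n × Fin d) (Fin n × Fin d) ℝ) (c₂ c₃ : ℝ) (x : Vec n d) :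
    ℕ → Counted (Vec n d)
  | 0 => pure (x - x)
  | m + 1 => do
      let s ← chebLoop W c₂ c₃ x m
      pure (x - s.a⁻¹ • s.x)

/-! ### Inner methods for an `L`-smooth convex function with gradient oracle `g` -/

section Inner

variable {E : Type} [NormedAddCommGroup E] [NormedSpace ℝ E]

/-- `m` iterations of gradient descent with step size `1 / L`. -/
def gradientDescent (g : E → Counted E) (L : ℝ) (x₀ : E) : ℕ → Counted E
  | 0 => pure x₀
  | m + 1 => do
      let x ← gradientDescent g L x₀ m
      let v ← g x
      pure (x - (1 / L) • v)

/-- The iterate `x_k`, the extrapolated point `y_k` and the weight `t_k` of fast gradient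
descent. -/
structure FGDState (E : Type) : Type where
  x : E
  y : E
  t : ℝ

/-- `m` iterations of Nesterov's fast gradient descent for convex functions. -/
def fastLoop (g : E → Counted E) (L : ℝ) (x₀ : E) : ℕ → Counted (FGDState E)
  | 0 => pure { x := x₀, y := x₀, t := 1 }
  | m + 1 => do
      let s ← fastLoop g L x₀ m
      let v ← g s.y
      let x' := s.y - (1 / L) • v
      let t' := (1 + √(1 + 4 * s.t ^ 2)) / 2
      pure { x := x', y := x' + ((s.t - 1) / t') • (x' - s.x), t := t' }

/-- The output of `m` iterations of fast gradient descent. -/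
def fastGradientDescent (g : E → Counted E) (L : ℝ) (x₀ : E) (m : ℕ) : Counted E := do
  let s ← fastLoop g L x₀ m
  pure s.x

/-- `fsfomWeightAux j = ϑ_{m-j}` for `j < m`, where `ϑ_m = 1` and
`ϑ_i = (1 + √(1 + 4 ϑ_{i+1}²)) / 2` for `0 < i < m`. -/
def fsfomWeightAux : ℕ → ℝ
  | 0 => 1
  | j + 1 => (1 + √(1 + 4 * fsfomWeightAux j ^ 2)) / 2

/-- The weights `ϑ_0, …, ϑ_m` of `m` iterations of FSFOM; `ϑ_0 = (1 + √(1 + 8 ϑ_1²)) / 2`. -/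
def fsfomWeight (m i : ℕ) : ℝ :=
  if i = 0 then (1 + √(1 + 8 * fsfomWeightAux (m - 1) ^ 2)) / 2 else fsfomWeightAux (m - i)

/-- The iterates `x_i` and `y_i` of FSFOM. -/
structure FSFOMState (E : Type) : Type where
  x : E
  y : E

/-- The first `i` of `m` iterations of FSFOM, the fixed-step first-order method of Kim and Fessler
for decreasing the gradient norm of smooth convex functions (OGM-G):
`y_{i+1} = x_i - ∇f(x_i) / L` and
`x_{i+1} = y_{i+1} + (ϑ_i - 1)(2 ϑ_{i+1} - 1) / (ϑ_i (2 ϑ_i - 1)) (y_{i+1} - y_i)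
  + (2 ϑ_{i+1} - 1) / (2 ϑ_i - 1) (y_{i+1} - x_i)`. -/
def fsfomLoop (g : E → Counted E) (L : ℝ) (x₀ : E) (m : ℕ) : ℕ → Counted (FSFOMState E)
  | 0 => pure { x := x₀, y := x₀ }
  | i + 1 => do
      let s ← fsfomLoop g L x₀ m i
      let v ← g s.x
      let y' := s.x - (1 / L) • v
      let p := fsfomWeight m i
      let q := fsfomWeight m (i + 1)
      pure { x := y' + ((p - 1) * (2 * q - 1) / (p * (2 * p - 1))) • (y' - s.y)
                + ((2 * q - 1) / (2 * p - 1)) • (y' - s.x),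
             y := y' }

/-- The output of `m` iterations of FSFOM. -/
def fsfom (g : E → Counted E) (L : ℝ) (x₀ : E) (m : ℕ) : Counted E := do
  let s ← fsfomLoop g L x₀ m m
  pure s.x

/-- The three inner methods: GD, FGD followed by GD, FGD followed by FSFOM. -/
inductive InnerMethod : Type
  | gd
  | fgdGd
  | fgdFsfom

/-- The exponent `α` of an inner method. -/
def InnerMethod.alpha : InnerMethod → ℝ
  | .gd => 2
  | .fgdGd => 3
  | .fgdFsfom => 4

/-- The constant `A` of an inner method. -/
def InnerMethod.const : InnerMethod → ℝ
  | .gd => 4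
  | .fgdGd => 64
  | .fgdFsfom => 256

/-- `T` iterations of an inner method, started at `x₀`; in the combinations, the first `⌊T / 2⌋`
iterations are made by the first method and the others by the second. -/
def InnerMethod.run (M : InnerMethod) (g : E → Counted E) (L : ℝ) (x₀ : E) (T : ℕ) : Counted E :=
  match M with
  | .gd => gradientDescent g L x₀ T
  | .fgdGd => do
      let z ← fastGradientDescent g L x₀ (T / 2)
      gradientDescent g L z (T - T / 2)
  | .fgdFsfom => do
      let z ← fastGradientDescent g L x₀ (T / 2)
      fsfom g L z (T - T / 2)

end Inner

/-! ### APDA with inexact prox and accelerated gossip -/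

/-- The parameters of the algorithm. -/
structure Params : Type where
  etaX : ℝ
  etaY : ℝ
  betaY : ℝ
  theta : ℝ
  c₂ : ℝ
  c₃ : ℝ
  N : ℕ
  T : ℕ

/-- `c₁ = (√χ - 1) / (√χ + 1)`. -/
def chebC₁ (χ : ℝ) : ℝ := (√χ - 1) / (√χ + 1)

/-- `N = ⌊√χ⌋`. -/
def gossipSteps (χ : ℝ) : ℕ := ⌊√χ⌋₊

/-- `2 c₁^N / (1 + c₁^{2N})`. -/
def chebRadius (χ : ℝ) : ℝ :=
  2 * chebC₁ χ ^ gossipSteps χ / (1 + chebC₁ χ ^ (2 * gossipSteps χ))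

def lambda₁ (χ : ℝ) : ℝ := 1 + chebRadius χ

def lambda₂ (χ : ℝ) : ℝ := 1 - chebRadius χ

/-- The choice of the parameters; `lmax = λ_max(W)`. For `χ = 1` one has `N = 1`, the procedure `AG`
returns `c₃ W x` whatever `c₂ ≠ 0` is, and `c₂` is set to `1`. -/
def apdaParams (M : InnerMethod) (μ L χ lmax : ℝ) : Params :=
  let etaX := 1 / (2 * √(L * μ)) * (lambda₂ χ / lambda₁ χ)
  let etaY := √(L * μ) / (√2 * lambda₁ χ * lambda₂ χ)
  let betaY := min (1 / L) (1 / (2 * lambda₁ χ ^ 2 * etaY))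
  { etaX := etaX
    etaY := etaY
    betaY := betaY
    theta := max (2 / (2 + μ * etaX)) (1 - lambda₂ χ ^ 2 * betaY * etaY)
    c₂ := if χ = 1 then 1 else (χ + 1) / (χ - 1)
    c₃ := 2 * χ / ((1 + χ) * lmax)
    N := gossipSteps χ
    T := ⌈(20 * M.const) ^ (1 / M.alpha) * (1 + √(L / μ)) ^ (2 / M.alpha)⌉₊ }

/-- The variables `𝐱ᵏ, 𝐲ᵏ, ȳᵏ` after `k` iterations, with the last approximate prox `x̂ᵏ⁻¹`
(for `k = 0` that field holds `𝐱⁰` and is not used). -/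
structure State (n d : ℕ) : Type where
  x : Vec n d
  y : Vec n d
  ybar : Vec n d
  xhat : Vec n d

variable {n d : ℕ}

/-- The linear map `𝐱 ↦ AG(W, 𝐱, N)`. -/
def gossipMap (W : Matrix (Fin n × Fin d) (Fin n × Fin d) ℝ) (p : Params) (x : Vec n d) : Vec n d :=
  (accGossip W p.c₂ p.c₃ x p.N).val

/-- The auxiliary function `Ψᵏ(z) = P(z) + ‖z - (𝐱ᵏ - η_x AG(W, ȳᵏ, N))‖² / (2 η_x)`. -/
def auxObjective (P : Vec n d → ℝ) (W : Matrix (Fin n × Fin d) (Fin n × Fin d) ℝ) (p : Params)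
    (s : State n d) (z : Vec n d) : ℝ :=
  P z + 1 / (2 * p.etaX) * ‖z - (s.x - p.etaX • gossipMap W p s.ybar)‖ ^ 2

/-- The minimizer `w⋆ᵏ` of `Ψᵏ`. -/
def auxMinimizer (P : Vec n d → ℝ) (W : Matrix (Fin n × Fin d) (Fin n × Fin d) ℝ) (p : Params)
    (s : State n d) : Vec n d :=
  Classical.epsilon fun w => ∀ z, auxObjective P W p s w ≤ auxObjective P W p s z

/-- One iteration of the algorithm for an `L`-smooth `P`. The inner method is applied to `Ψᵏ`, which
is `(L + 1 / η_x)`-smooth, from the starting point `𝐱ᵏ`; each of its gradients takes one evaluation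
of `∇P`. -/
def apdaStep (M : InnerMethod) (L : ℝ) (P : Vec n d → ℝ)
    (W : Matrix (Fin n × Fin d) (Fin n × Fin d) ℝ) (p : Params) (s : State n d) :
    Counted (State n d) := do
  let u ← accGossip W p.c₂ p.c₃ s.ybar p.N
  let auxGrad : Vec n d → Counted (Vec n d) := fun z => do
    let v ← gradOracle P z
    pure (v + (1 / p.etaX) • (z - (s.x - p.etaX • u)))
  let xhat ← M.run auxGrad (L + 1 / p.etaX) s.x p.T
  let v ← gradOracle P xhat
  let a ← accGossip W p.c₂ p.c₃ xhat p.N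
  let b ← accGossip W p.c₂ p.c₃ s.y p.N
  let c ← accGossip W p.c₂ p.c₃ (b + v) p.N
  let y' := s.y + p.etaY • (a - p.betaY • c)
  pure { x := s.x - p.etaX • (v + u)
         y := y'
         ybar := y' + p.theta • (y' - s.y)
         xhat := xhat }

/-- `k` iterations of the algorithm from `(𝐱⁰, 𝐲⁰)`. -/
def apda (M : InnerMethod) (L : ℝ) (P : Vec n d → ℝ)
    (W : Matrix (Fin n × Fin d) (Fin n × Fin d) ℝ) (p : Params) (x₀ y₀ : Vec n d) :
    ℕ → Counted (State n d)
  | 0 => pure { x := x₀, y := y₀, ybar := y₀, xhat := x₀ }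
  | k + 1 => do
      let s ← apda M L P W p x₀ y₀ k
      apdaStep M L P W p s

/-- `(x⋆, y⋆)` solves `min_𝐱 max_𝐲 P(𝐱) + ⟨𝐲, K 𝐱⟩`. -/
def IsSaddlePoint (P : Vec n d → ℝ) (K : Vec n d → Vec n d) (xs ys : Vec n d) : Prop :=
  (∀ y, P xs + inner ℝ y (K xs) ≤ P xs + inner ℝ ys (K xs)) ∧
  (∀ x, P xs + inner ℝ ys (K xs) ≤ P x + inner ℝ ys (K x))

/-- The Lyapunov function `Δᵏ` along the run of the algorithm from `(𝐱⁰, 𝐲⁰)`. -/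
def lyapunov (M : InnerMethod) (μ L : ℝ) (P : Vec n d → ℝ)
    (W : Matrix (Fin n × Fin d) (Fin n × Fin d) ℝ) (p : Params) (x₀ y₀ xs ys : Vec n d) : ℕ → ℝ
  | 0 => (1 + μ * p.etaX / 2) * (1 / p.etaX) * ‖x₀ - xs‖ ^ 2 + 1 / p.etaY * ‖y₀ - ys‖ ^ 2
  | k + 1 =>
      let s := (apda M L P W p x₀ y₀ k).val
      let s' := (apda M L P W p x₀ y₀ (k + 1)).val
      (1 + μ * p.etaX / 2) * (1 / p.etaX) * ‖s'.x - xs‖ ^ 2 + 1 / p.etaY * ‖s'.y - ys‖ ^ 2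
        + 1 / (2 * p.etaY) * ‖s'.y - s.y‖ ^ 2
        + 1 / (8 * p.etaX) * ‖s.x - auxMinimizer P W p s‖ ^ 2
        - 2 * inner ℝ (gossipMap W p s'.y - gossipMap W p s.y) (s'.xhat - xs)

end Decentralized

end

/-! In an eigenbasis of `W` the gossip recursion is the three-term Chebyshev recursion, so `K`
multiplies the eigenspace of `l` by `1 - T_N(c₂(1 - c₃ l)) / T_N(c₂)`. This is `0` at `l = 0`. For
`l` between `λ⁺_min` and `λ_max` the argument lies in `[-1, 1]`, where `|T_N| ≤ 1`, so the factor
lies in `[λ₂, λ₁]`. The choice `N = ⌊√χ⌋` keeps `λ₂ / λ₁ ≥ 1/16`: at the price of `√χ` rounds, `K`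
is well conditioned off the kernel of `W`, and `χ` disappears from the iteration count
(`exists_gossip_linearMap`, `lambda_ratio_ge`).

For such a `K`, one iteration is an inexact primal-dual step (`primalDual_step`,
`lyapunovValue_step`). Strong convexity contracts the primal error. The term `β_y K(K y + ∇P)`
contracts the dual error, because `y - y⋆` stays in a subspace on which `K` is bounded below;
cocoercivity of `∇P` pays for the gradient error in that term. Extrapolation by exactly `θ` turns
the coupling product of one iteration into `θ` times that of the previous one, up to a cross term
that the remaining squares of `Δ` absorb.

Both effects of the inexact prox are controlled by `G = ∇Ψ(x̂)`: the new primal point is `x̂ - η_x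
G`, and `‖x̂ - w⋆‖ ≤ η_x ‖G‖`. It therefore suffices that `η_x ‖G‖` be a fixed fraction of `‖x -
w⋆‖`, which needs no logarithmic factor. The inner methods give `‖G‖² ≤ (A/2) ℓ² ‖x - w⋆‖² / T^α`
(`InnerMethod.run_bound`), and `η_x ℓ = O(√κ)`, so `T = O(κ^{1/α})` is enough (`prox_accuracy`).

Finally `1 - θ ≥ 1/(512 √κ)` (`theta_le`), so `O(√κ log(1/ε))` iterations suffice, each costing `T +
1` gradients and `4N` rounds. -/

namespace Decentralized

/-! ### Smooth convex functions -/

section Convex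

variable {E : Type} [NormedAddCommGroup E] [InnerProductSpace ℝ E]

/-- The interpolation inequality of an `L`-smooth convex function `f` with gradient map `g`. -/
def SmoothConvex (L : ℝ) (f : E → ℝ) (g : E → E) : Prop :=
  ∀ x y, f x + inner ℝ (g x) (y - x) + 1 / (2 * L) * ‖g y - g x‖ ^ 2 ≤ f y

/-- Compare the supporting plane at `x` with the quadratic upper model at `y`, both evaluated at `y
- (g y - g x) / L`, the minimizer of the model minus the plane. -/
theorem smoothConvex_of_bounds {L : ℝ} (hL : 0 < L) {f : E → ℝ} {g : E → E}
    (hc : ∀ x y, f x + inner ℝ (g x) (y - x) ≤ f y)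
    (hs : ∀ x y, f y ≤ f x + inner ℝ (g x) (y - x) + L / 2 * ‖y - x‖ ^ 2) :
    SmoothConvex L f g := by
  intro x y
  set v := g y - g x with hv
  have h1 := hc x (y - (1 / L) • v)
  have h2 := hs y (y - (1 / L) • v)
  have e1 : y - (1 / L) • v - x = (y - x) - (1 / L) • v := by abel
  have e2 : y - (1 / L) • v - y = -((1 / L) • v) := by abel
  rw [e1, inner_sub_right, real_inner_smul_right] at h1
  rw [e2, inner_neg_right, real_inner_smul_right, norm_neg, norm_smul, mul_pow] at h2
  have e3 : inner ℝ (g y) v - inner ℝ (g x) v = ‖v‖ ^ 2 := by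
    rw [← inner_sub_left, ← hv, real_inner_self_eq_norm_sq]
  have e4 : ‖(1 / L : ℝ)‖ ^ 2 = 1 / L ^ 2 := by
    rw [Real.norm_eq_abs, sq_abs]; field_simp
  rw [e4] at h2
  have e5 : L / 2 * (1 / L ^ 2 * ‖v‖ ^ 2) = 1 / (2 * L) * ‖v‖ ^ 2 := by field_simp
  have e6 : 1 / L * inner ℝ (g y) v - 1 / L * inner ℝ (g x) v
      = 2 * (1 / (2 * L) * ‖v‖ ^ 2) := by
    rw [← mul_sub, e3]; field_simp
  linarith

namespace SmoothConvex

variable {L : ℝ} {f : E → ℝ} {g : E → E}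

theorem le_inner (h : SmoothConvex L f g) (x y : E) :
    1 / L * ‖g x - g y‖ ^ 2 ≤ inner ℝ (g x - g y) (x - y) := by
  have h1 := h x y
  have h2 := h y x
  have e1 : inner ℝ (g x) (y - x) = - inner ℝ (g x) (x - y) := by
    rw [← inner_neg_right, neg_sub]
  rw [norm_sub_rev, e1] at h1
  rw [inner_sub_left]
  have : 1 / L * ‖g x - g y‖ ^ 2 = 2 * (1 / (2 * L) * ‖g x - g y‖ ^ 2) := by ring
  linarith

theorem convex (h : SmoothConvex L f g) (hL : 0 < L) (x y : E) :
    f x + inner ℝ (g x) (y - x) ≤ f y := by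
  have h1 := h x y
  have : 0 ≤ 1 / (2 * L) * ‖g y - g x‖ ^ 2 := by positivity
  linarith

/-- Interpolation from the new point back to `x`: for step size `1 / L` the cross terms cancel
exactly, leaving a decrease by the squares of both gradients. -/
theorem step_le (h : SmoothConvex L f g) (hL : 0 < L) (x : E) :
    f (x - (1 / L) • g x) + 1 / (2 * L) * ‖g x‖ ^ 2
      + 1 / (2 * L) * ‖g (x - (1 / L) • g x)‖ ^ 2 ≤ f x := by
  have h1 := h (x - (1 / L) • g x) x
  set u := g (x - (1 / L) • g x)
  rw [sub_sub_cancel, real_inner_smul_right, norm_sub_sq_real] at h1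
  have e : 1 / (2 * L) * (‖g x‖ ^ 2 - 2 * inner ℝ (g x) u + ‖u‖ ^ 2)
    = 1 / (2 * L) * ‖g x‖ ^ 2 - 1 / L * inner ℝ u (g x) + 1 / (2 * L) * ‖u‖ ^ 2 := by
    rw [real_inner_comm]; field_simp
  linarith

/-- Cocoercivity between `x` and the new point reduces to `‖u‖² ≤ ⟨u, g x⟩`, where `u` is the new
gradient; Cauchy-Schwarz finishes. -/
theorem norm_step_le (h : SmoothConvex L f g) (hL : 0 < L) (x : E) :
    ‖g (x - (1 / L) • g x)‖ ≤ ‖g x‖ := by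
  have h1 := h.le_inner x (x - (1 / L) • g x)
  set u := g (x - (1 / L) • g x)
  rw [sub_sub_cancel, real_inner_smul_right] at h1
  have h2 := le_of_mul_le_mul_left h1 (by positivity)
  rw [norm_sub_sq_real, inner_sub_left, real_inner_self_eq_norm_sq] at h2
  have h3 := real_inner_le_norm (g x) u
  rw [real_inner_comm] at h3
  have h4 : ‖u‖ ^ 2 ≤ ‖u‖ * ‖g x‖ := by rw [real_inner_comm] at h2; linarith
  by_contra! hlt
  nlinarith [norm_nonneg (g x), norm_nonneg u]

theorem norm_sq_le (h : SmoothConvex L f g) {xs : E} (hxs : g xs = 0) (x : E) :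
    1 / (2 * L) * ‖g x‖ ^ 2 ≤ f x - f xs := by
  have h1 := h xs x
  rw [hxs] at h1
  simp only [inner_zero_left, sub_zero] at h1
  linarith

end SmoothConvex

end Convex

/-! ### Rates of the inner methods -/

section Rates

variable {E : Type} [NormedAddCommGroup E] [InnerProductSpace ℝ E]
  {L : ℝ} {f : E → ℝ} {g : E → Counted E}

theorem gradientDescent_val_succ (g : E → Counted E) (L : ℝ) (x₀ : E) (m : ℕ) :
    (gradientDescent g L x₀ (m + 1)).val = (gradientDescent g L x₀ m).val
      - (1 / L) • (g (gradientDescent g L x₀ m).val).val := rfl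

/-- The gradient bound of gradient descent in terms of the initial functional gap. -/
theorem gradientDescent_gap (h : SmoothConvex L f fun x => (g x).val) (hL : 0 < L) {xs : E}
    (hxs : (g xs).val = 0) (x₀ : E) (m : ℕ) :
    (m + 1) * ‖(g (gradientDescent g L x₀ m).val).val‖ ^ 2 ≤ 2 * L * (f x₀ - f xs) := by
  -- Gradient norms do not increase, so the latest one bounds from below the decrease made at every
  -- earlier step. `norm_sq_le` at the last iterate later raises the factor `m` to `m + 1`.
  have key : f (gradientDescent g L x₀ m).val
      + m * (1 / (2 * L) * ‖(g (gradientDescent g L x₀ m).val).val‖ ^ 2) ≤ f x₀ := by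
    induction m with
    | zero => simp [gradientDescent, pure]
    | succ m ih =>
      rw [gradientDescent_val_succ]
      set x := (gradientDescent g L x₀ m).val
      have h1 := h.step_le hL x
      have h2 := h.norm_step_le hL x
      have h3 : ‖(g (x - (1 / L) • (g x).val)).val‖ ^ 2 ≤ ‖(g x).val‖ ^ 2 := by gcongr
      have h4 : 1 / (2 * L) * ‖(g (x - (1 / L) • (g x).val)).val‖ ^ 2
        ≤ 1 / (2 * L) * ‖(g x).val‖ ^ 2 := by gcongr
      have h5 : (m : ℝ) * (1 / (2 * L) * ‖(g (x - (1 / L) • (g x).val)).val‖ ^ 2)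
        ≤ m * (1 / (2 * L) * ‖(g x).val‖ ^ 2) := by gcongr
      have h6 : 0 ≤ 1 / (2 * L) * ‖(g x).val‖ ^ 2 := by positivity
      push_cast
      linarith
  have h1 := h.norm_sq_le hxs (gradientDescent g L x₀ m).val
  have h2 : (m + 1) * (1 / (2 * L) * ‖(g (gradientDescent g L x₀ m).val).val‖ ^ 2)
    ≤ f x₀ - f xs := by linarith
  calc _ = 2 * L * ((m + 1) *
        (1 / (2 * L) * ‖(g (gradientDescent g L x₀ m).val).val‖ ^ 2)) := by field_simp
    _ ≤ _ := by gcongr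

/-- The gradient bound of gradient descent in terms of the initial distance. -/
theorem gradientDescent_dist (h : SmoothConvex L f fun x => (g x).val) (hL : 0 < L) {xs : E}
    (hxs : (g xs).val = 0) (x₀ : E) (m : ℕ) :
    (m : ℝ) ^ 2 * ‖(g (gradientDescent g L x₀ m).val).val‖ ^ 2 ≤ 2 * L ^ 2 * ‖x₀ - xs‖ ^ 2 := by
  -- A potential mixing gap, distance and gradient norm. Its growth is paid by `step_le` with weight
  -- `2(m+1)/L`, convexity towards `xs` with weight `2/L`, and monotonicity of the gradient norm.
  -- Bounding the gap below by `norm_sq_le` raises the gradient coefficient from `m(m-1)/2` to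
  -- `m(m+1)/2`.
  have key : 2 * m / L * (f (gradientDescent g L x₀ m).val - f xs)
      + ‖(gradientDescent g L x₀ m).val - xs‖ ^ 2
      + (m * (m - 1) / 2) / L ^ 2 * ‖(g (gradientDescent g L x₀ m).val).val‖ ^ 2
      ≤ ‖x₀ - xs‖ ^ 2 := by
    induction m with
    | zero => simp [gradientDescent, pure]
    | succ m ih =>
      rw [gradientDescent_val_succ]
      set x := (gradientDescent g L x₀ m).val
      have h1 := h.step_le hL x
      have h2 := h.norm_step_le hL x
      have h3 := h.convex hL x xs
      set v := (g x).val
      set v' := (g (x - (1 / L) • v)).val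
      have h4 : ‖v'‖ ^ 2 ≤ ‖v‖ ^ 2 := by gcongr
      have e1 : x - (1 / L) • v - xs = (x - xs) - (1 / L) • v := by abel
      have e2 : inner ℝ v (xs - x) = - inner ℝ v (x - xs) := by rw [← inner_neg_right, neg_sub]
      rw [e1, norm_sub_sq_real, real_inner_smul_right, real_inner_comm, norm_smul, mul_pow,
        Real.norm_eq_abs, sq_abs]
      rw [e2] at h3
      set I := inner ℝ v (x - xs)
      have h1' := mul_le_mul_of_nonneg_left h1 (show (0 : ℝ) ≤ 2 * (m + 1) / L by positivity)
      have h3' := mul_le_mul_of_nonneg_left h3 (show (0 : ℝ) ≤ 2 / L by positivity)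
      have h4' := mul_le_mul_of_nonneg_left h4
        (show (0 : ℝ) ≤ (m * (m + 1) / 2) / L ^ 2 by positivity)
      have h5 : (0 : ℝ) ≤ 1 / L ^ 2 * ‖v'‖ ^ 2 * (m + 1) := by positivity
      have h1'' : 2 * (m + 1) / L * f (x - (1 / L) • v) + (m + 1) / L ^ 2 * ‖v‖ ^ 2
          + (m + 1) / L ^ 2 * ‖v'‖ ^ 2 ≤ 2 * (m + 1) / L * f x := by
        refine le_trans (le_of_eq ?_) h1'
        field_simp
      have e5 : (m * (m + 1) / 2) / L ^ 2 * ‖v‖ ^ 2 =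
        (m * (m - 1) / 2) / L ^ 2 * ‖v‖ ^ 2 + m / L ^ 2 * ‖v‖ ^ 2 := by ring
      have e6 : 2 * (m + 1) / L * f x = 2 * m / L * f x + 2 / L * f x := by ring
      have e7 : 2 * ((m : ℝ) + 1) / L * f xs = 2 * m / L * f xs + 2 / L * f xs := by ring
      have e8 : (m + 1) / L ^ 2 * ‖v‖ ^ 2 = m / L ^ 2 * ‖v‖ ^ 2 + (1 / L) ^ 2 * ‖v‖ ^ 2 := by
        field_simp
      push_cast
      have e9 : ((m : ℝ) + 1) * (m + 1 - 1) / 2 / L ^ 2 * ‖v'‖ ^ 2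
        = (m * (m + 1) / 2) / L ^ 2 * ‖v'‖ ^ 2 := by ring
      rw [e9, mul_sub, e7]
      rw [mul_sub] at ih
      have e10 : 2 * (1 / L * I) = 2 / L * I := by ring
      have h6 : 0 ≤ (m + 1) / L ^ 2 * ‖v'‖ ^ 2 := by positivity
      rw [e10]
      linarith
  have h1 := h.norm_sq_le hxs (gradientDescent g L x₀ m).val
  set v := (g (gradientDescent g L x₀ m).val).val
  have h2 := mul_le_mul_of_nonneg_left h1 (show (0 : ℝ) ≤ 2 * m / L by positivity)
  have h3 : (m * (m + 1) / 2) / L ^ 2 * ‖v‖ ^ 2 ≤ ‖x₀ - xs‖ ^ 2 := by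
    have : (m * (m + 1) / 2) / L ^ 2 * ‖v‖ ^ 2 = 2 * m / L * (1 / (2 * L) * ‖v‖ ^ 2)
      + (m * (m - 1) / 2) / L ^ 2 * ‖v‖ ^ 2 := by field_simp; ring
    have h4 := sq_nonneg ‖(gradientDescent g L x₀ m).val - xs‖
    linarith
  calc (m : ℝ) ^ 2 * ‖v‖ ^ 2 ≤ m * (m + 1) * ‖v‖ ^ 2 := by
        gcongr; nlinarith [Nat.cast_nonneg (α := ℝ) m]
    _ = 2 * L ^ 2 * ((m * (m + 1) / 2) / L ^ 2 * ‖v‖ ^ 2) := by field_simp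
    _ ≤ _ := by gcongr

theorem fastLoop_val_succ (g : E → Counted E) (L : ℝ) (x₀ : E) (m : ℕ) :
    (fastLoop g L x₀ (m + 1)).val =
      { x := (fastLoop g L x₀ m).val.y - (1 / L) • (g (fastLoop g L x₀ m).val.y).val
        y := ((fastLoop g L x₀ m).val.y - (1 / L) • (g (fastLoop g L x₀ m).val.y).val)
          + (((fastLoop g L x₀ m).val.t - 1) / ((1 + √(1 + 4 * (fastLoop g L x₀ m).val.t ^ 2)) / 2))
            • (((fastLoop g L x₀ m).val.y - (1 / L) • (g (fastLoop g L x₀ m).val.y).val)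
              - (fastLoop g L x₀ m).val.x)
        t := (1 + √(1 + 4 * (fastLoop g L x₀ m).val.t ^ 2)) / 2 } := rfl

/-- The relation between consecutive weights that makes the potentials of both FGD and FSFOM
telescope. -/
theorem weight_sq (t : ℝ) :
    ((1 + √(1 + 4 * t ^ 2)) / 2) ^ 2 - (1 + √(1 + 4 * t ^ 2)) / 2 = t ^ 2 := by
  have := Real.sq_sqrt (show 0 ≤ 1 + 4 * t ^ 2 by positivity)
  linear_combination this / 4

theorem weight_ge (t : ℝ) : t + 1 / 2 ≤ (1 + √(1 + 4 * t ^ 2)) / 2 := by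
  have : 2 * t ≤ √(1 + 4 * t ^ 2) := Real.le_sqrt_of_sq_le (by nlinarith)
  linarith

theorem fastLoop_t_ge (g : E → Counted E) (L : ℝ) (x₀ : E) (m : ℕ) :
    ((m : ℝ) + 2) / 2 ≤ (fastLoop g L x₀ m).val.t := by
  induction m with
  | zero => simp [fastLoop, pure]
  | succ m ih =>
    rw [fastLoop_val_succ]
    have := weight_ge (fastLoop g L x₀ m).val.t
    push_cast
    linarith

/-- Nesterov's potential. The point `x + t(y - x)` moves by `-(t / L)` times the gradient at `y`,
and the resulting inner product is controlled by convexity at `y` towards `x` (weight `t - 1`) and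
towards `xs` (weight `1`). The coefficient `t² - t` is the square of the preceding weight, and is
`0` at the start. -/
theorem fastLoop_potential (h : SmoothConvex L f fun x => (g x).val) (hL : 0 < L) 
    (xs x₀ : E) (m : ℕ) :
    2 / L * ((fastLoop g L x₀ m).val.t ^ 2 - (fastLoop g L x₀ m).val.t)
        * (f (fastLoop g L x₀ m).val.x - f xs)
      + ‖(fastLoop g L x₀ m).val.x + (fastLoop g L x₀ m).val.t •
          ((fastLoop g L x₀ m).val.y - (fastLoop g L x₀ m).val.x) - xs‖ ^ 2 ≤ ‖x₀ - xs‖ ^ 2 := by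
  induction m with
  | zero => simp [fastLoop, pure]
  | succ m ih =>
    have ht := fastLoop_t_ge g L x₀ m
    rw [fastLoop_val_succ]
    simp only
    set s := (fastLoop g L x₀ m).val
    set x := s.x
    set y := s.y
    set t := s.t
    have ht1 : 1 ≤ t := by
      have : (0 : ℝ) ≤ m := Nat.cast_nonneg m
      linarith
    rw [weight_sq]
    set t' := (1 + √(1 + 4 * t ^ 2)) / 2 with ht'
    have ht'0 : t' ≠ 0 := by
      have := weight_ge t
      rw [← ht'] at this
      linarith
    have h1 := h.step_le hL y
    have h2 := h.convex hL y x
    have h3 := h.convex hL y xs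
    set v := (g y).val
    have hp : 0 ≤ 1 / (2 * L) * ‖(g (y - (1 / L) • v)).val‖ ^ 2 := by positivity
    have e0 : y - (1 / L) • v + t' • (y - (1 / L) • v
          + ((t - 1) / t') • (y - (1 / L) • v - x) - (y - (1 / L) • v)) - xs
        = (x + t • (y - x) - xs) - (t / L) • v := by
      rw [add_sub_cancel_left, smul_smul, mul_div_cancel₀ _ ht'0]
      module
    rw [e0, norm_sub_sq_real, real_inner_smul_right, real_inner_comm, norm_smul, mul_pow,
        Real.norm_eq_abs, sq_abs]
    have e1 : x + t • (y - x) - xs = (t - 1) • (y - x) + (y - xs) := by module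
    have e2 : inner ℝ v (x - y) = - inner ℝ v (y - x) := by rw [← inner_neg_right, neg_sub]
    have e3 : inner ℝ v (xs - y) = - inner ℝ v (y - xs) := by rw [← inner_neg_right, neg_sub]
    have e4 : inner ℝ v (x + t • (y - x) - xs)
        = (t - 1) * inner ℝ v (y - x) + inner ℝ v (y - xs) := by
      rw [e1, inner_add_right, real_inner_smul_right]
    rw [e4]
    rw [e2] at h2
    rw [e3] at h3
    have h1' := mul_le_mul_of_nonneg_left (le_trans (le_add_of_nonneg_right hp) h1)
      (show (0 : ℝ) ≤ 2 / L * t ^ 2 by positivity)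
    have h2' := mul_le_mul_of_nonneg_left h2
      (show (0 : ℝ) ≤ 2 / L * (t * (t - 1)) by
        have : 0 ≤ t - 1 := by linarith
        positivity)
    have h3' := mul_le_mul_of_nonneg_left h3 (show (0 : ℝ) ≤ 2 / L * t by positivity)
    have e5 : 2 / L * t ^ 2 * (f (y - (1 / L) • v) + 1 / (2 * L) * ‖v‖ ^ 2)
      = 2 / L * t ^ 2 * f (y - (1 / L) • v) + (t / L) ^ 2 * ‖v‖ ^ 2 := by field_simp
    rw [e5] at h1'
    refine le_trans ?_ ih
    have e6 : 2 * (t / L * ((t - 1) * inner ℝ v (y - x) + inner ℝ v (y - xs)))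
      = 2 / L * (t * (t - 1)) * inner ℝ v (y - x) + 2 / L * t * inner ℝ v (y - xs) := by ring
    rw [e6]
    have e7 : 2 / L * (t ^ 2 - t) = 2 / L * (t * (t - 1)) := by ring
    have e8 : 2 / L * t ^ 2 = 2 / L * (t * (t - 1)) + 2 / L * t := by ring
    rw [e7]
    rw [e8] at h1' ⊢
    nlinarith

/-- The functional rate of fast gradient descent. -/
theorem fastGradientDescent_gap (h : SmoothConvex L f fun x => (g x).val) (hL : 0 < L) {xs : E}
    (hxs : (g xs).val = 0) (x₀ : E) (m : ℕ) :
    ((m : ℝ) + 2) ^ 2 * (f (fastGradientDescent g L x₀ (m + 1)).val - f xs)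
      ≤ 2 * L * ‖x₀ - xs‖ ^ 2 := by
  have h1 := fastLoop_potential h hL xs x₀ (m + 1)
  have h2 : (fastLoop g L x₀ (m + 1)).val.t ^ 2 - (fastLoop g L x₀ (m + 1)).val.t
      = (fastLoop g L x₀ m).val.t ^ 2 := weight_sq _
  have h3 := fastLoop_t_ge g L x₀ m
  have h4 : (fastGradientDescent g L x₀ (m + 1)).val = (fastLoop g L x₀ (m + 1)).val.x := rfl
  rw [h2, ← h4] at h1
  set t := (fastLoop g L x₀ m).val.t
  set d := f (fastGradientDescent g L x₀ (m + 1)).val - f xs with hd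
  have hd0 : 0 ≤ d := by
    have := h.norm_sq_le hxs (fastGradientDescent g L x₀ (m + 1)).val
    have h5 : 0 ≤ 1 / (2 * L) * ‖(g (fastGradientDescent g L x₀ (m + 1)).val).val‖ ^ 2 := by
      positivity
    linarith
  have h6 : 2 / L * t ^ 2 * d ≤ ‖x₀ - xs‖ ^ 2 := le_trans (le_add_of_nonneg_right (sq_nonneg _)) h1
  calc ((m : ℝ) + 2) ^ 2 * d = 4 * (((m : ℝ) + 2) / 2) ^ 2 * d := by ring
    _ ≤ 4 * t ^ 2 * d := by gcongr
    _ = 2 * L * (2 / L * t ^ 2 * d) := by field_simp; ring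
    _ ≤ _ := by gcongr

end Rates

/-! ### The gradient-norm rate of FSFOM -/

section Fsfom

variable {E : Type} [NormedAddCommGroup E] [InnerProductSpace ℝ E]

/-- The coupling of two consecutive iterates of FSFOM, where `v` and `z` are the auxiliary
sequences of the potential and `a` stands for the last iterate minus its gradient step. -/
theorem fsfom_potential_step {L : ℝ} (hL : 0 < L) {f : E → ℝ} {g : E → E}
    (h : SmoothConvex L f g) {p q : ℝ} (hp : 0 < p) (x y v xK : E)
    (hpq : q ^ 2 = p ^ 2 - p) (hx : x = y + (2 * p - 1) • v)
    {y' v' x' : E} (hy' : y' = x - (1 / L) • g x)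
    (hv' : v' = (1 / p) • ((p - 1) • v - (1 / L) • g x)) (hx' : x' = y' + (2 * q - 1) • v') :
    p * (1 / (2 * L) * ‖g xK‖ ^ 2 + 1 / (2 * L) * ‖g x'‖ ^ 2 + f x' - f xK
        - (2 * q - 1) * inner ℝ (g x') v'
        + L * inner ℝ v' (y' + q ^ 2 • v' - (xK - (1 / L) • g xK)))
      ≤ (p - 1) * (1 / (2 * L) * ‖g xK‖ ^ 2 + 1 / (2 * L) * ‖g x‖ ^ 2 + f x - f xK
        - (2 * p - 1) * inner ℝ (g x) v
        + L * inner ℝ v (y + p ^ 2 • v - (xK - (1 / L) • g xK))) := by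
  -- Only two interpolation inequalities are needed: from `x'` to `x` with weight `p`, and from `x`
  -- to the last iterate `xK` with weight `1`.
  have h1 := mul_le_mul_of_nonneg_left (h x' x) hp.le
  have h2 := h x xK
  have e1 : x - x' = (1 / L) • g x - (2 * q - 1) • v' := by rw [hx', hy']; module
  have e2 : p • v' = (p - 1) • v - (1 / L) • g x := by
    rw [hv', smul_smul, mul_one_div_cancel hp.ne', one_smul]
  set d := xK - x with hd
  have e3 : xK = d + x := by rw [hd]; abel
  have e4 : p * (L * inner ℝ v' (y' + q ^ 2 • v' - (xK - (1 / L) • g xK)))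
      = L * inner ℝ ((p - 1) • v - (1 / L) • g x)
        (-d - (1 / L) • g x + (p - 1) • ((p - 1) • v - (1 / L) • g x) + (1 / L) • g xK) := by
    rw [← e2]
    rw [real_inner_smul_left, mul_left_comm]
    congr 3
    rw [hpq, hy', e3, smul_smul]
    module
  have e5 : y + p ^ 2 • v - (xK - (1 / L) • g xK)
      = -d + (p - 1) ^ 2 • v + (1 / L) • g xK := by
    rw [e3, hx]; module
  rw [mul_add, e4, e5]
  rw [e1] at h1
  generalize g xK = gK at *
  generalize g x' = g' at *
  generalize g x = G at *
  simp only [← real_inner_self_eq_norm_sq, inner_add_right, inner_sub_left,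
    inner_sub_right, real_inner_smul_left, real_inner_smul_right, inner_neg_right] at h1 h2 ⊢
  rw [real_inner_comm G gK, real_inner_comm G g'] at *
  rw [real_inner_comm G v] at *
  field_simp at h1 h2 ⊢
  nlinarith [h1, h2]

/-- The first iteration is separate because `ϑ₀` obeys `2ϑ₁² = ϑ₀² - ϑ₀`. The starting direction is
zero, so the right side involves only the initial value and the data at `xK`. -/
theorem fsfom_potential_first {L : ℝ} (hL : 0 < L) {f : E → ℝ} {g : E → E}
    (h : SmoothConvex L f g) {p q : ℝ} (hp : 0 < p) (x xK : E)
    (hpq : 2 * q ^ 2 = p ^ 2 - p) {y' v' x' : E} (hy' : y' = x - (1 / L) • g x)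
    (hv' : v' = -(1 / p) • (1 / L) • g x) (hx' : x' = y' + (2 * q - 1) • v') :
    p * (1 / (2 * L) * ‖g xK‖ ^ 2 + 1 / (2 * L) * ‖g x'‖ ^ 2 + f x' - f xK
        - (2 * q - 1) * inner ℝ (g x') v'
        + L * inner ℝ v' (y' + q ^ 2 • v' - (xK - (1 / L) • g xK)))
      ≤ (p - 1) * (1 / (2 * L) * ‖g xK‖ ^ 2 + f x - f xK) := by
  have h1 := mul_le_mul_of_nonneg_left (h x' x) hp.le
  have h2 := h x xK
  have e1 : x - x' = (1 / L) • g x - (2 * q - 1) • v' := by rw [hx', hy']; module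
  have e2 : p • v' = -(1 / L) • g x := by
    rw [hv', smul_smul, mul_neg, mul_one_div_cancel hp.ne', neg_smul, one_smul, neg_smul]
  set d := xK - x with hd
  have e3 : xK = d + x := by rw [hd]; abel
  have hq : q ^ 2 = (p - 1) / 2 * p := by linear_combination hpq / 2
  have e4 : p * (L * inner ℝ v' (y' + q ^ 2 • v' - (xK - (1 / L) • g xK)))
      = L * inner ℝ (-(1 / L) • g x)
        (-d - (1 / L) • g x + ((p - 1) / 2) • (-(1 / L) • g x) + (1 / L) • g xK) := by
    rw [← e2, real_inner_smul_left, mul_left_comm]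
    congr 3
    rw [hq, hy', e3, smul_smul]
    module
  rw [mul_add, e4]
  rw [e1] at h1
  generalize g xK = gK at *
  generalize g x' = g' at *
  generalize g x = G at *
  simp only [← real_inner_self_eq_norm_sq, inner_add_right, inner_sub_left,
    inner_sub_right, real_inner_smul_left, real_inner_smul_right, inner_neg_right] at h1 h2 ⊢
  rw [real_inner_comm G gK, real_inner_comm G g'] at *
  field_simp at h1 h2 ⊢
  nlinarith [h1, h2]

theorem fsfomWeightAux_ge (j : ℕ) : ((j : ℝ) + 2) / 2 ≤ fsfomWeightAux j := by
  induction j with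
  | zero => simp [fsfomWeightAux]
  | succ j ih =>
    have := weight_ge (fsfomWeightAux j)
    rw [fsfomWeightAux]
    push_cast
    linarith

theorem one_le_fsfomWeightAux (j : ℕ) : 1 ≤ fsfomWeightAux j := by
  have := fsfomWeightAux_ge j
  have : (0 : ℝ) ≤ j := Nat.cast_nonneg j
  linarith

theorem fsfomWeight_zero_sq (m : ℕ) :
    2 * fsfomWeight (m + 1) 1 ^ 2 = fsfomWeight (m + 1) 0 ^ 2 - fsfomWeight (m + 1) 0 := by
  have := Real.sq_sqrt (show 0 ≤ 1 + 8 * fsfomWeightAux m ^ 2 by positivity)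
  simp only [fsfomWeight, if_true, one_ne_zero, if_false, Nat.add_sub_cancel]
  linear_combination -this / 4

theorem fsfomWeight_zero_ge (m : ℕ) :
    ((m : ℝ) + 2) ^ 2 / 2 ≤ fsfomWeight (m + 1) 0 ^ 2 := by
  have h1 := fsfomWeight_zero_sq m
  have h2 : fsfomWeight (m + 1) 1 = fsfomWeightAux m := by simp [fsfomWeight]
  have h3 := fsfomWeightAux_ge m
  have h4 : 0 ≤ fsfomWeight (m + 1) 0 := by
    simp only [fsfomWeight, if_true]; positivity
  have h5 : (((m : ℝ) + 2) / 2) ^ 2 ≤ fsfomWeightAux m ^ 2 := by gcongr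
  rw [h2] at h1
  nlinarith

theorem one_le_fsfomWeight (m i : ℕ) : 1 ≤ fsfomWeight m i := by
  unfold fsfomWeight
  split_ifs
  · have : 1 ≤ √(1 + 8 * fsfomWeightAux (m - 1) ^ 2) :=
      Real.le_sqrt_of_sq_le (by nlinarith [sq_nonneg (fsfomWeightAux (m - 1))])
    linarith
  · exact one_le_fsfomWeightAux _

theorem fsfomWeight_succ_sq {m i : ℕ} (hi : 0 < i) (him : i < m) :
    fsfomWeight m (i + 1) ^ 2 = fsfomWeight m i ^ 2 - fsfomWeight m i := by
  have : m - i = (m - (i + 1)) + 1 := by omega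
  simp only [fsfomWeight, hi.ne', if_false, Nat.succ_ne_zero]
  rw [this, fsfomWeightAux, weight_sq]

theorem fsfomWeight_self {m : ℕ} (hm : 0 < m) : fsfomWeight m m = 1 := by
  simp [fsfomWeight, hm.ne', fsfomWeightAux]

/-- The direction `(x_i - y_i) / (2 ϑ_i - 1)` of FSFOM. -/
noncomputable def fsfomDir (g : E → Counted E) (L : ℝ) (x₀ : E) (m i : ℕ) : E :=
  (1 / (2 * fsfomWeight m i - 1)) •
    ((fsfomLoop g L x₀ m i).val.x - (fsfomLoop g L x₀ m i).val.y)

section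

variable (g : E → Counted E) (L : ℝ) (x₀ : E) (m i : ℕ)

theorem fsfomLoop_x_eq : (fsfomLoop g L x₀ m i).val.x = (fsfomLoop g L x₀ m i).val.y
    + (2 * fsfomWeight m i - 1) • fsfomDir g L x₀ m i := by
  have := one_le_fsfomWeight m i
  rw [fsfomDir, smul_smul, mul_one_div_cancel (by linarith), one_smul]
  abel

theorem fsfomLoop_y_succ : (fsfomLoop g L x₀ m (i + 1)).val.y = (fsfomLoop g L x₀ m i).val.x
    - (1 / L) • (g (fsfomLoop g L x₀ m i).val.x).val := rfl

/-- In this variable the two-term momentum of the method becomes a one-term averaging recursion, the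
form in which the potential is analysed. -/
theorem fsfomDir_succ : fsfomDir g L x₀ m (i + 1) = (1 / fsfomWeight m i) •
    ((fsfomWeight m i - 1) • fsfomDir g L x₀ m i
      - (1 / L) • (g (fsfomLoop g L x₀ m i).val.x).val) := by
  have hx : (fsfomLoop g L x₀ m (i + 1)).val.x = (fsfomLoop g L x₀ m (i + 1)).val.y
      + ((fsfomWeight m i - 1) * (2 * fsfomWeight m (i + 1) - 1)
        / (fsfomWeight m i * (2 * fsfomWeight m i - 1)))
        • ((fsfomLoop g L x₀ m (i + 1)).val.y - (fsfomLoop g L x₀ m i).val.y)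
      + ((2 * fsfomWeight m (i + 1) - 1) / (2 * fsfomWeight m i - 1))
        • ((fsfomLoop g L x₀ m (i + 1)).val.y - (fsfomLoop g L x₀ m i).val.x) := rfl
  rw [fsfomDir, hx, fsfomLoop_y_succ]
  have hx' := fsfomLoop_x_eq g L x₀ m i
  set x := (fsfomLoop g L x₀ m i).val.x
  set v := (g x).val
  have hp := one_le_fsfomWeight m i
  have hq := one_le_fsfomWeight m (i + 1)
  set p := fsfomWeight m i
  set q := fsfomWeight m (i + 1)
  have hp1 : 2 * p - 1 ≠ 0 := by linarith
  have hq1 : 2 * q - 1 ≠ 0 := by linarith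
  have hp0 : p ≠ 0 := by linarith
  have e1 : x - (1 / L) • v - (fsfomLoop g L x₀ m i).val.y
      = (2 * p - 1) • fsfomDir g L x₀ m i - (1 / L) • v := by
    rw [hx']; abel
  rw [e1]
  set D := fsfomDir g L x₀ m i
  have e2 : x - (1 / L) • v - x = -((1 / L) • v) := by abel
  rw [e2]
  set V := (1 / L) • v
  match_scalars <;> field_simp <;> ring

end

/-- The gradient bound of FSFOM in terms of the initial functional gap. -/
theorem fsfom_gap {L : ℝ} {f : E → ℝ} {g : E → Counted E}
    (h : SmoothConvex L f fun x => (g x).val) (hL : 0 < L) {xs : E}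
    (hxs : (g xs).val = 0) (x₀ : E) (m : ℕ) :
    ((m : ℝ) + 2) ^ 2 * ‖(g (fsfom g L x₀ (m + 1)).val).val‖ ^ 2 ≤ 4 * L * (f x₀ - f xs) := by
  have hout : (fsfom g L x₀ (m + 1)).val = (fsfomLoop g L x₀ (m + 1) (m + 1)).val.x := rfl
  rw [hout]
  set xK := (fsfomLoop g L x₀ (m + 1) (m + 1)).val.x with hxK
  set G := 1 / (2 * L) * ‖(g xK).val‖ ^ 2 + f x₀ - f xK with hG
  set p₀ := fsfomWeight (m + 1) 0 with hp₀
  have hp₀1 : 1 ≤ p₀ := one_le_fsfomWeight _ _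
  -- The potential divided by `ϑ²` is nonincreasing: each step multiplies the potential by at most
  -- `(p - 1) / p`, which is `q² / p²` since `q² = p² - p`. The first step contributes the factor
  -- `2`.
  have key : ∀ i : ℕ, i < m + 1 →
      (1 / (2 * L) * ‖(g xK).val‖ ^ 2
        + 1 / (2 * L) * ‖(g (fsfomLoop g L x₀ (m + 1) (i + 1)).val.x).val‖ ^ 2
        + f (fsfomLoop g L x₀ (m + 1) (i + 1)).val.x - f xK
        - (2 * fsfomWeight (m + 1) (i + 1) - 1)
          * inner ℝ (g (fsfomLoop g L x₀ (m + 1) (i + 1)).val.x).val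
            (fsfomDir g L x₀ (m + 1) (i + 1))
        + L * inner ℝ (fsfomDir g L x₀ (m + 1) (i + 1))
          ((fsfomLoop g L x₀ (m + 1) (i + 1)).val.y
            + fsfomWeight (m + 1) (i + 1) ^ 2 • fsfomDir g L x₀ (m + 1) (i + 1)
            - (xK - (1 / L) • (g xK).val))) * p₀ ^ 2
        ≤ 2 * fsfomWeight (m + 1) (i + 1) ^ 2 * G := by
    intro i hi
    induction i with
    | zero =>
      have hx0 : (fsfomLoop g L x₀ (m + 1) 0).val.x = x₀ := rfl
      have h1 := fsfom_potential_first hL h (lt_of_lt_of_le one_pos hp₀1) x₀ xK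
        (fsfomWeight_zero_sq m) (fsfomLoop_y_succ g L x₀ (m + 1) 0)
        (v' := fsfomDir g L x₀ (m + 1) 1)
        (by
          have h0 : fsfomDir g L x₀ (m + 1) 0 = 0 := by simp [fsfomDir, fsfomLoop, pure]
          rw [fsfomDir_succ, h0, smul_zero, zero_sub, smul_neg, neg_smul]
          rfl)
        (fsfomLoop_x_eq g L x₀ (m + 1) 1)
      rw [← hG] at h1
      simp only [zero_add]
      rw [fsfomWeight_zero_sq, ← hp₀]
      have h2 := mul_le_mul_of_nonneg_right h1 (show 0 ≤ p₀ by linarith)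
      refine le_trans (le_of_eq ?_) (h2.trans (le_of_eq ?_))
      · ring
      · ring
    | succ i ih =>
      have ih := ih (by omega)
      have hp := one_le_fsfomWeight (m + 1) (i + 1)
      have hpq := fsfomWeight_succ_sq (m := m + 1) (i := i + 1) (by omega) hi
      have h1 := fsfom_potential_step hL h (p := fsfomWeight (m + 1) (i + 1)) (by linarith)
        _ _ _ xK hpq (fsfomLoop_x_eq g L x₀ (m + 1) (i + 1))
        (fsfomLoop_y_succ g L x₀ (m + 1) (i + 1)) (fsfomDir_succ g L x₀ (m + 1) (i + 1))
        (fsfomLoop_x_eq g L x₀ (m + 1) (i + 1 + 1))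
      have h2 := mul_le_mul_of_nonneg_right h1 (sq_nonneg p₀)
      have h3 := mul_le_mul_of_nonneg_left ih
        (show 0 ≤ fsfomWeight (m + 1) (i + 1) - 1 by linarith)
      rw [mul_assoc, mul_assoc] at h2
      have h4 := h2.trans h3
      rw [hpq] at h4 ⊢
      refine le_of_mul_le_mul_left (h4.trans (le_of_eq ?_))
        (show 0 < fsfomWeight (m + 1) (i + 1) by linarith)
      ring
  have h1 := key m (Nat.lt_succ_self m)
  have hx := fsfomLoop_x_eq g L x₀ (m + 1) (m + 1)
  rw [fsfomWeight_self (Nat.succ_pos m), ← hxK] at h1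
  rw [fsfomWeight_self (Nat.succ_pos m), ← hxK] at hx
  set v := fsfomDir g L x₀ (m + 1) (m + 1)
  set y := (fsfomLoop g L x₀ (m + 1) (m + 1)).val.y
  -- At the last index the weight is `1`, so the two inner products in the potential cancel and only
  -- `‖g xK‖² / L` remains.
  have e1 : y + (1 : ℝ) ^ 2 • v - (xK - (1 / L) • (g xK).val) = (1 / L) • (g xK).val := by
    rw [hx]; module
  rw [e1, real_inner_smul_right, real_inner_comm] at h1
  have e2 : L * (1 / L * inner ℝ v (g xK).val) = inner ℝ v (g xK).val := by field_simp
  rw [e2] at h1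
  have h2 := h.norm_sq_le hxs xK
  have h3 := fsfomWeight_zero_ge m
  rw [← hp₀] at h3
  have h4 : 1 / L * ‖(g xK).val‖ ^ 2 * p₀ ^ 2 ≤ 2 * (f x₀ - f xs) := by
    have e3 : 1 / L * ‖(g xK).val‖ ^ 2 = 2 * (1 / (2 * L) * ‖(g xK).val‖ ^ 2) := by ring
    rw [e3]
    rw [hG] at h1
    nlinarith
  calc ((m : ℝ) + 2) ^ 2 * ‖(g xK).val‖ ^ 2
      = 2 * (((m : ℝ) + 2) ^ 2 / 2) * ‖(g xK).val‖ ^ 2 := by ring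
    _ ≤ 2 * p₀ ^ 2 * ‖(g xK).val‖ ^ 2 := by gcongr
    _ = 2 * L * (1 / L * ‖(g xK).val‖ ^ 2 * p₀ ^ 2) := by field_simp
    _ ≤ 2 * L * (2 * (f x₀ - f xs)) := by gcongr
    _ = _ := by ring

end Fsfom

/-! ### A common rate for the three inner methods -/

section InnerMethods

variable {E : Type} [NormedAddCommGroup E] [InnerProductSpace ℝ E]

/-- The exponent `α` as a natural number. -/
def InnerMethod.alphaNat : InnerMethod → ℕ
  | .gd => 2
  | .fgdGd => 3
  | .fgdFsfom => 4

theorem InnerMethod.alpha_eq (M : InnerMethod) : M.alpha = M.alphaNat := by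
  cases M <;> norm_num [InnerMethod.alpha, InnerMethod.alphaNat]

/-- The gradient bound of the inner methods. -/
theorem InnerMethod.run_bound (M : InnerMethod) {L : ℝ} {f : E → ℝ} {g : E → Counted E}
    (h : SmoothConvex L f fun x => (g x).val) (hL : 0 < L) {xs : E}
    (hxs : (g xs).val = 0) (x₀ : E) {T : ℕ} (hT : 2 ≤ T) :
    (T : ℝ) ^ M.alphaNat * ‖(g (M.run g L x₀ T).val).val‖ ^ 2
      ≤ M.const / 2 * L ^ 2 * ‖x₀ - xs‖ ^ 2 := by
  -- The assumption `2 ≤ T` gives FGD at least one iteration; its rate is stated for `m + 1`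
  -- iterations.
  obtain ⟨k, hk⟩ : ∃ k, T / 2 = k + 1 := ⟨T / 2 - 1, by omega⟩
  have hTk : (T : ℝ) / 2 ≤ k + 2 := by
    have : T ≤ 2 * (k + 2) := by omega
    have : (T : ℝ) ≤ 2 * (k + 2) := by exact_mod_cast this
    linarith
  have fgd : (T : ℝ) ^ 2 * (f (fastGradientDescent g L x₀ (T / 2)).val - f xs)
      ≤ 8 * L * ‖x₀ - xs‖ ^ 2 := by
    have h1 := fastGradientDescent_gap h hL hxs x₀ k
    rw [← hk] at h1
    have h2 := h.norm_sq_le hxs (fastGradientDescent g L x₀ (T / 2)).val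
    have h3 : 0 ≤ f (fastGradientDescent g L x₀ (T / 2)).val - f xs :=
      le_trans (by positivity) h2
    calc (T : ℝ) ^ 2 * (f (fastGradientDescent g L x₀ (T / 2)).val - f xs)
        = 4 * (((T : ℝ) / 2) ^ 2 * (f (fastGradientDescent g L x₀ (T / 2)).val - f xs)) := by ring
      _ ≤ 4 * (((k : ℝ) + 2) ^ 2 * (f (fastGradientDescent g L x₀ (T / 2)).val - f xs)) := by
          gcongr
      _ ≤ 4 * (2 * L * ‖x₀ - xs‖ ^ 2) := by gcongr
      _ = _ := by ring
  obtain ⟨m, hm⟩ : ∃ m, T - T / 2 = m + 1 := ⟨T - T / 2 - 1, by omega⟩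
  have hTm : (T : ℝ) / 2 ≤ m + 1 := by
    have : T ≤ 2 * (m + 1) := by omega
    have : (T : ℝ) ≤ 2 * (m + 1) := by exact_mod_cast this
    linarith
  cases M with
  | gd =>
    refine (gradientDescent_dist h hL hxs x₀ T).trans (le_of_eq ?_)
    norm_num [InnerMethod.const]
  | fgdGd =>
    have hrun : (InnerMethod.fgdGd.run g L x₀ T).val
      = (gradientDescent g L (fastGradientDescent g L x₀ (T / 2)).val (T - T / 2)).val := rfl
    have h1 := gradientDescent_gap h hL hxs (fastGradientDescent g L x₀ (T / 2)).val (T - T / 2)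
    rw [← hrun, hm] at h1
    set V := ‖(g (InnerMethod.fgdGd.run g L x₀ T).val).val‖ ^ 2
    set d := f (fastGradientDescent g L x₀ (T / 2)).val - f xs
    have hV : 0 ≤ V := by positivity
    calc (T : ℝ) ^ 3 * V = 2 * T ^ 2 * (T / 2 * V) := by ring
      _ ≤ 2 * T ^ 2 * (((m + 1 : ℕ) + 1) * V) := by gcongr; push_cast; linarith
      _ ≤ 2 * T ^ 2 * (2 * L * d) := by gcongr
      _ = 4 * L * (T ^ 2 * d) := by ring
      _ ≤ 4 * L * (8 * L * ‖x₀ - xs‖ ^ 2) := by gcongr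
      _ = _ := by norm_num [InnerMethod.const]; ring
  | fgdFsfom =>
    have hrun : (InnerMethod.fgdFsfom.run g L x₀ T).val
      = (fsfom g L (fastGradientDescent g L x₀ (T / 2)).val (T - T / 2)).val := rfl
    rw [hm] at hrun
    have h1 := fsfom_gap h hL hxs (fastGradientDescent g L x₀ (T / 2)).val m
    rw [← hrun] at h1
    set V := ‖(g (InnerMethod.fgdFsfom.run g L x₀ T).val).val‖ ^ 2
    set d := f (fastGradientDescent g L x₀ (T / 2)).val - f xs
    calc (T : ℝ) ^ 4 * V = 4 * T ^ 2 * ((T / 2) ^ 2 * V) := by ring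
      _ ≤ 4 * T ^ 2 * (((m : ℝ) + 2) ^ 2 * V) := by gcongr; linarith
      _ ≤ 4 * T ^ 2 * (4 * L * d) := by gcongr
      _ = 16 * L * (T ^ 2 * d) := by ring
      _ ≤ 16 * L * (8 * L * ‖x₀ - xs‖ ^ 2) := by gcongr
      _ = _ := by norm_num [InnerMethod.const]; ring

/-! ### Oracle calls of the inner methods -/

@[simp] theorem Counted.grads_bind {α β : Type} (m : Counted α) (f : α → Counted β) :
    (m >>= f).grads = m.grads + (f m.val).grads := rfl

@[simp] theorem Counted.comms_bind {α β : Type} (m : Counted α) (f : α → Counted β) :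
    (m >>= f).comms = m.comms + (f m.val).comms := rfl

@[simp] theorem Counted.grads_pure {α : Type} (a : α) : (pure a : Counted α).grads = 0 := rfl

@[simp] theorem Counted.comms_pure {α : Type} (a : α) : (pure a : Counted α).comms = 0 := rfl

variable {g : E → Counted E}

theorem gradientDescent_grads (hg : ∀ x, (g x).grads = 1) (L : ℝ) (x₀ : E) (m : ℕ) :
    (gradientDescent g L x₀ m).grads = m := by
  induction m with
  | zero => rfl
  | succ m ih => simp [gradientDescent, ih, hg]

theorem gradientDescent_comms (hg : ∀ x, (g x).comms = 0) (L : ℝ) (x₀ : E) (m : ℕ) :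
    (gradientDescent g L x₀ m).comms = 0 := by
  induction m with
  | zero => rfl
  | succ m ih => simp [gradientDescent, ih, hg]

theorem fastGradientDescent_grads (hg : ∀ x, (g x).grads = 1) (L : ℝ) (x₀ : E) (m : ℕ) :
    (fastGradientDescent g L x₀ m).grads = m := by
  simp only [fastGradientDescent, Counted.grads_bind, Counted.grads_pure, add_zero]
  induction m with
  | zero => rfl
  | succ m ih => simp [fastLoop, ih, hg]

theorem fastGradientDescent_comms (hg : ∀ x, (g x).comms = 0) (L : ℝ) (x₀ : E) (m : ℕ) :
    (fastGradientDescent g L x₀ m).comms = 0 := by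
  simp only [fastGradientDescent, Counted.comms_bind, Counted.comms_pure, add_zero]
  induction m with
  | zero => rfl
  | succ m ih => simp [fastLoop, ih, hg]

theorem fsfomLoop_grads (hg : ∀ x, (g x).grads = 1) (L : ℝ) (x₀ : E) (m i : ℕ) :
    (fsfomLoop g L x₀ m i).grads = i := by
  induction i with
  | zero => rfl
  | succ i ih => simp [fsfomLoop, ih, hg]

theorem fsfomLoop_comms (hg : ∀ x, (g x).comms = 0) (L : ℝ) (x₀ : E) (m i : ℕ) :
    (fsfomLoop g L x₀ m i).comms = 0 := by
  induction i with
  | zero => rfl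
  | succ i ih => simp [fsfomLoop, ih, hg]

theorem InnerMethod.run_grads (M : InnerMethod) (hg : ∀ x, (g x).grads = 1) (L : ℝ) (x₀ : E)
    (T : ℕ) : (M.run g L x₀ T).grads = T := by
  cases M with
  | gd => exact gradientDescent_grads hg L x₀ T
  | fgdGd =>
    simp only [InnerMethod.run, Counted.grads_bind, fastGradientDescent_grads hg,
      gradientDescent_grads hg]
    omega
  | fgdFsfom =>
    simp only [InnerMethod.run, Counted.grads_bind, fastGradientDescent_grads hg,
      fsfom, fsfomLoop_grads hg, Counted.grads_pure]
    omega

theorem InnerMethod.run_comms (M : InnerMethod) (hg : ∀ x, (g x).comms = 0) (L : ℝ) (x₀ : E)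
    (T : ℕ) : (M.run g L x₀ T).comms = 0 := by
  cases M with
  | gd => exact gradientDescent_comms hg L x₀ T
  | fgdGd =>
    simp only [InnerMethod.run, Counted.comms_bind, fastGradientDescent_comms hg,
      gradientDescent_comms hg]
  | fgdFsfom =>
    simp only [InnerMethod.run, Counted.comms_bind, fastGradientDescent_comms hg,
      fsfom, fsfomLoop_comms hg, Counted.comms_pure]

end InnerMethods

/-! ### Oracle calls of gossip and of the outer loop -/

section Costs

variable {n d : ℕ}

theorem chebLoop_grads (W : Matrix (Fin n × Fin d) (Fin n × Fin d) ℝ) (c₂ c₃ : ℝ) (x : Vec n d)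
    (m : ℕ) : (chebLoop W c₂ c₃ x m).grads = 0 := by
  induction m with
  | zero => simp [chebLoop, gossip]
  | succ m ih => simp [chebLoop, gossip, ih]

theorem chebLoop_comms (W : Matrix (Fin n × Fin d) (Fin n × Fin d) ℝ) (c₂ c₃ : ℝ) (x : Vec n d)
    (m : ℕ) : (chebLoop W c₂ c₃ x m).comms = m + 1 := by
  induction m with
  | zero => simp [chebLoop, gossip]
  | succ m ih => simp [chebLoop, gossip, ih]

theorem accGossip_grads (W : Matrix (Fin n × Fin d) (Fin n × Fin d) ℝ) (c₂ c₃ : ℝ) (x : Vec n d)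
    (N : ℕ) : (accGossip W c₂ c₃ x N).grads = 0 := by
  cases N <;> simp [accGossip, chebLoop_grads]

theorem accGossip_comms (W : Matrix (Fin n × Fin d) (Fin n × Fin d) ℝ) (c₂ c₃ : ℝ) (x : Vec n d)
    (N : ℕ) : (accGossip W c₂ c₃ x N).comms = N := by
  cases N <;> simp [accGossip, chebLoop_comms]

/-- The extra gradient is the one at the approximate prox; it serves both the primal and the dual
update. -/
theorem apda_grads (M : InnerMethod) (L : ℝ) (P : Vec n d → ℝ)
    (W : Matrix (Fin n × Fin d) (Fin n × Fin d) ℝ) (p : Params) (x₀ y₀ : Vec n d) (k : ℕ) :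
    (apda M L P W p x₀ y₀ k).grads = k * (p.T + 1) := by
  induction k with
  | zero => simp [apda]
  | succ k ih =>
    simp only [apda, apdaStep, Counted.grads_bind, Counted.grads_pure, accGossip_grads, ih]
    rw [InnerMethod.run_grads]
    · simp only [gradOracle]; ring
    · intro x; rfl

theorem apda_comms (M : InnerMethod) (L : ℝ) (P : Vec n d → ℝ)
    (W : Matrix (Fin n × Fin d) (Fin n × Fin d) ℝ) (p : Params) (x₀ y₀ : Vec n d) (k : ℕ) :
    (apda M L P W p x₀ y₀ k).comms = k * (4 * p.N) := by
  induction k with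
  | zero => simp [apda]
  | succ k ih =>
    simp only [apda, apdaStep, Counted.comms_bind, Counted.comms_pure, accGossip_comms, ih]
    rw [InnerMethod.run_comms]
    · simp only [gradOracle]; ring
    · intro x; rfl

end Costs

/-! ### Chebyshev parameters -/

-- The identity `T_m(cosh s) = cosh(m s)` in the variable `c = exp(-s)`. It evaluates the
-- normalization of the gossip polynomial at `c₂ = (c₁ + c₁⁻¹) / 2`.
open Polynomial in
theorem eval_T_half_add_inv {c : ℝ} (hc : c ≠ 0) (m : ℕ) :
    (Chebyshev.T ℝ m).eval ((c + c⁻¹) / 2) = (c ^ m + (c ^ m)⁻¹) / 2 := by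
  induction m using Nat.twoStepInduction with
  | zero => simp
  | one => simp
  | more m h1 h2 =>
    push_cast
    rw [Chebyshev.T_add_two]
    push_cast at h1 h2
    simp only [eval_sub, eval_mul, eval_ofNat, eval_X, h1, h2]
    field_simp
    ring

theorem one_le_gossipSteps {χ : ℝ} (hχ : 1 ≤ χ) : 1 ≤ gossipSteps χ :=
  Nat.le_floor (by simpa using Real.one_le_sqrt.2 hχ)

theorem gossipSteps_le {χ : ℝ} : (gossipSteps χ : ℝ) ≤ √χ := Nat.floor_le (Real.sqrt_nonneg _)

theorem chebC₁_nonneg {χ : ℝ} (hχ : 1 ≤ χ) : 0 ≤ chebC₁ χ := by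
  have := Real.one_le_sqrt.2 hχ
  exact div_nonneg (by linarith) (by linarith)

/-- Bernoulli's inequality for `c₁⁻¹ = 1 + 2 / (√χ - 1)`, with `N > √χ - 1`. The constant is not
sharp; any absolute bound below `1` would serve. -/
theorem chebC₁_pow_le {χ : ℝ} (hχ : 1 ≤ χ) : chebC₁ χ ^ gossipSteps χ ≤ 3 / 5 := by
  have hs := Real.one_le_sqrt.2 hχ
  have hN := one_le_gossipSteps hχ
  have hN' : (1 : ℝ) ≤ gossipSteps χ := by exact_mod_cast hN
  have hlt : √χ < gossipSteps χ + 1 := Nat.lt_floor_add_one _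
  set s := √χ with hsd
  set N := gossipSteps χ
  have hc : chebC₁ χ = (s - 1) / (s + 1) := rfl
  rcases hs.eq_or_lt with h1 | h1
  · rw [hc, ← h1, sub_self, zero_div, zero_pow (by omega)]; norm_num
  have hcpos : 0 < chebC₁ χ := by rw [hc]; exact div_pos (by linarith) (by linarith)
  have hb := one_add_mul_le_pow (a := 2 / (s - 1))
    (by have : 0 ≤ 2 / (s - 1) := div_nonneg (by norm_num) (by linarith)
        linarith) N
  have h2 : 1 + 2 / (s - 1) = (chebC₁ χ)⁻¹ := by
    have : s - 1 ≠ 0 := by linarith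
    rw [hc]; field_simp; ring
  rw [h2, inv_pow] at hb
  have h3 : (5 : ℝ) / 3 ≤ 1 + N * (2 / (s - 1)) := by
    have : (2 : ℝ) / 3 ≤ N * (2 / (s - 1)) := by
      rw [mul_div_assoc', div_le_div_iff₀ (by norm_num) (by linarith)]
      linarith
    linarith
  have h4 := inv_anti₀ (by norm_num) (h3.trans hb)
  rw [inv_inv] at h4
  linarith

section Radius

variable {χ : ℝ}

theorem chebRadius_eq : chebRadius χ = 2 * chebC₁ χ ^ gossipSteps χ
    / (1 + (chebC₁ χ ^ gossipSteps χ) ^ 2) := by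
  rw [chebRadius, ← pow_mul, mul_comm 2 (gossipSteps χ)]

theorem chebRadius_nonneg (hχ : 1 ≤ χ) : 0 ≤ chebRadius χ := by
  have := chebC₁_nonneg hχ
  rw [chebRadius_eq]; positivity

/-- The function `2u / (1 + u²)` increases on `[0, 1]` and equals `15/17` at `u = 3/5`. -/
theorem chebRadius_le (hχ : 1 ≤ χ) : chebRadius χ ≤ 15 / 17 := by
  have h1 := chebC₁_pow_le hχ
  have h0 : 0 ≤ chebC₁ χ ^ gossipSteps χ := pow_nonneg (chebC₁_nonneg hχ) _
  rw [chebRadius_eq, div_le_div_iff₀ (by positivity) (by norm_num)]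
  nlinarith

theorem lambda₂_ge (hχ : 1 ≤ χ) : 2 / 17 ≤ lambda₂ χ := by
  have := chebRadius_le hχ
  unfold lambda₂; linarith

theorem lambda₂_pos (hχ : 1 ≤ χ) : 0 < lambda₂ χ := by
  have := lambda₂_ge hχ
  linarith

theorem one_le_lambda₁ (hχ : 1 ≤ χ) : 1 ≤ lambda₁ χ := by
  have := chebRadius_nonneg hχ
  unfold lambda₁; linarith

theorem lambda₂_le_one (hχ : 1 ≤ χ) : lambda₂ χ ≤ 1 := by
  have := chebRadius_nonneg hχ
  unfold lambda₂; linarith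

theorem lambda_ratio_ge (hχ : 1 ≤ χ) : 1 / 16 ≤ lambda₂ χ / lambda₁ χ := by
  have h := chebRadius_le hχ
  have h1 := one_le_lambda₁ hχ
  rw [div_le_div_iff₀ (by norm_num) (by linarith)]
  unfold lambda₁ lambda₂; linarith

theorem lambda_ratio_le (hχ : 1 ≤ χ) : lambda₂ χ / lambda₁ χ ≤ 1 := by
  have h1 := one_le_lambda₁ hχ
  have h2 := lambda₂_le_one hχ
  rw [div_le_one (by linarith)]
  linarith

end Radius

/-- The eigenvalue of accelerated gossip for a nonzero eigenvalue of the gossip matrix. -/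
theorem cheb_eigenvalue_bounds {χ lmax l : ℝ} (hχ : 1 ≤ χ) (hlmax : 0 < lmax)
    (hl : lmax / χ ≤ l) (hl' : l ≤ lmax) :
    let c₂ : ℝ := if χ = 1 then 1 else (χ + 1) / (χ - 1)
    let c₃ : ℝ := 2 * χ / ((1 + χ) * lmax)
    let T := Polynomial.Chebyshev.T ℝ (gossipSteps χ)
    T.eval c₂ ≠ 0 ∧ lambda₂ χ ≤ 1 - (T.eval c₂)⁻¹ * T.eval (c₂ * (1 - c₃ * l)) ∧
      1 - (T.eval c₂)⁻¹ * T.eval (c₂ * (1 - c₃ * l)) ≤ lambda₁ χ := by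
  intro c₂ c₃ T
  -- When `χ = 1` the only admissible `l` is `lmax`, the polynomial is `X`, and all three quantities
  -- equal `1`.
  rcases hχ.eq_or_lt with h1 | h1
  · subst h1
    have hN : gossipSteps 1 = 1 := by simp [gossipSteps]
    have hc : chebC₁ 1 = 0 := by simp [chebC₁]
    have hr : chebRadius 1 = 0 := by simp [chebRadius, hN, hc]
    have hl1 : l = lmax := le_antisymm hl' (by simpa using hl)
    have e : 2 * 1 / ((1 + 1) * lmax) * lmax = 1 := by field_simp; norm_num
    have hT : T = Polynomial.X := by simp [T, hN]
    have hc2 : c₂ = 1 := by simp [c₂]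
    have hc3 : c₃ * l = 1 := by rw [hl1]; exact e
    rw [hT, hc2, hc3]
    simp [lambda₁, lambda₂, hr]
  · have hs1 : 1 < √χ := by rw [Real.lt_sqrt (by norm_num)]; linarith
    have hsq : √χ ^ 2 = χ := Real.sq_sqrt (by linarith)
    have hc2 : c₂ = (chebC₁ χ + (chebC₁ χ)⁻¹) / 2 := by
      have e1 : √χ - 1 ≠ 0 := by linarith
      have e2 : χ - 1 ≠ 0 := by linarith
      have e3 : √χ + 1 ≠ 0 := by linarith
      have : c₂ = (χ + 1) / (χ - 1) := if_neg h1.ne'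
      rw [this, chebC₁, inv_div]
      field_simp
      rw [← hsq]
      ring_nf
      rw [Real.sqrt_sq (by linarith)]
      ring
    have hcpos : 0 < chebC₁ χ := div_pos (by linarith) (by linarith)
    have hu : 0 < chebC₁ χ ^ gossipSteps χ := pow_pos hcpos _
    have ha : T.eval c₂ = (chebC₁ χ ^ gossipSteps χ + (chebC₁ χ ^ gossipSteps χ)⁻¹) / 2 := by
      rw [hc2]; exact eval_T_half_add_inv hcpos.ne' _
    have ha0 : 0 < T.eval c₂ := by rw [ha]; positivity
    have hr : (T.eval c₂)⁻¹ = chebRadius χ := by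
      rw [ha, chebRadius_eq]; field_simp
      ring
    -- The constants `c₂`, `c₃` are those for which this affine function of `l` maps `[lmax / χ,
    -- lmax]` onto `[-1, 1]`.
    have ht : |c₂ * (1 - c₃ * l)| ≤ 1 := by
      have hc2' : c₂ = (χ + 1) / (χ - 1) := if_neg h1.ne'
      have hχ0 : 0 < χ := by linarith
      have hm : 0 < χ - 1 := by linarith
      have e : c₂ * (1 - c₃ * l) = ((1 + χ) * lmax - 2 * χ * l) / ((χ - 1) * lmax) := by
        rw [hc2']; simp only [c₃]; field_simp; ring
      rw [div_le_iff₀ hχ0] at hl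
      rw [e, abs_div, abs_of_pos (mul_pos hm hlmax), div_le_one (mul_pos hm hlmax), abs_le]
      constructor <;> nlinarith
    have hb := Polynomial.Chebyshev.abs_eval_T_real_le_one (gossipSteps χ) ht
    rw [abs_le] at hb
    have hr0 := chebRadius_nonneg hχ
    refine ⟨ha0.ne', ?_, ?_⟩
    · rw [hr, lambda₂]; nlinarith [hb.1, hb.2]
    · rw [hr, lambda₁]; nlinarith [hb.1, hb.2]

/-! ### Spectral analysis of accelerated gossip -/

section Spectral

variable {n d : ℕ} {W : Matrix (Fin n × Fin d) (Fin n × Fin d) ℝ}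

theorem inner_eigenvectorBasis_mul (hW : W.IsHermitian) (i : Fin n × Fin d) (v : Vec n d) :
    inner ℝ (hW.eigenvectorBasis i) (Matrix.toEuclideanLin W v)
      = hW.eigenvalues i * inner ℝ (hW.eigenvectorBasis i) v := by
  have h1 := (Matrix.isSymmetric_toEuclideanLin_iff.2 hW) (hW.eigenvectorBasis i) v
  rw [← h1]
  have h2 : Matrix.toEuclideanLin W (hW.eigenvectorBasis i)
      = hW.eigenvalues i • hW.eigenvectorBasis i := by
    ext j
    have := congrFun (hW.mulVec_eigenvectorBasis i) j
    simpa [Matrix.toEuclideanLin] using this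
  rw [h2, real_inner_smul_left]

-- On an eigenvector coordinate, multiplication by `W` is a scalar, so both recursions are the
-- Chebyshev recursion: evaluated at `c₂` for the weights and at `c₂(1 - c₃ l)` for the vectors.
open Polynomial in
theorem chebLoop_val (hW : W.IsHermitian) (c₂ c₃ : ℝ) (x : Vec n d) (i : Fin n × Fin d) (m : ℕ) :
    (chebLoop W c₂ c₃ x m).val.aPrev = (Chebyshev.T ℝ m).eval c₂ ∧
    (chebLoop W c₂ c₃ x m).val.a = (Chebyshev.T ℝ (m + 1)).eval c₂ ∧
    inner ℝ (hW.eigenvectorBasis i) (chebLoop W c₂ c₃ x m).val.xPrev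
      = (Chebyshev.T ℝ m).eval (c₂ * (1 - c₃ * hW.eigenvalues i))
        * inner ℝ (hW.eigenvectorBasis i) x ∧
    inner ℝ (hW.eigenvectorBasis i) (chebLoop W c₂ c₃ x m).val.x
      = (Chebyshev.T ℝ (m + 1)).eval (c₂ * (1 - c₃ * hW.eigenvalues i))
        * inner ℝ (hW.eigenvectorBasis i) x := by
  induction m with
  | zero =>
    refine ⟨by simp [chebLoop, bind, pure], by simp [chebLoop, bind, pure],
      by simp [chebLoop, bind, pure], ?_⟩
    have : (chebLoop W c₂ c₃ x 0).val.x = c₂ • (x - c₃ • Matrix.toEuclideanLin W x) := rfl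
    rw [this, real_inner_smul_right, inner_sub_right, real_inner_smul_right,
      inner_eigenvectorBasis_mul]
    simp
    ring
  | succ m ih =>
    obtain ⟨h1, h2, h3, h4⟩ := ih
    have hc : ((m + 1 : ℕ) : ℤ) = m + 1 := by push_cast; rfl
    have hT : ∀ t : ℝ, (Chebyshev.T ℝ ((m : ℤ) + 1 + 1)).eval t
        = 2 * t * (Chebyshev.T ℝ ((m : ℤ) + 1)).eval t - (Chebyshev.T ℝ (m : ℤ)).eval t := by
      intro t
      have : (m : ℤ) + 1 + 1 = m + 2 := by ring
      rw [this, Chebyshev.T_add_two]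
      simp
    rw [hc, hT, hT]
    refine ⟨h2, ?_, h4, ?_⟩
    · have : (chebLoop W c₂ c₃ x (m + 1)).val.a = 2 * c₂ * (chebLoop W c₂ c₃ x m).val.a
        - (chebLoop W c₂ c₃ x m).val.aPrev := rfl
      rw [this, h1, h2]
    · have : (chebLoop W c₂ c₃ x (m + 1)).val.x = (2 * c₂) • ((chebLoop W c₂ c₃ x m).val.x
        - c₃ • Matrix.toEuclideanLin W (chebLoop W c₂ c₃ x m).val.x)
        - (chebLoop W c₂ c₃ x m).val.xPrev := rfl
      rw [this, inner_sub_right, real_inner_smul_right, inner_sub_right, real_inner_smul_right,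
        inner_eigenvectorBasis_mul, h3, h4]
      ring

theorem inner_accGossip (hW : W.IsHermitian) (c₂ c₃ : ℝ) (x : Vec n d) (i : Fin n × Fin d)
    {N : ℕ} (hN : 1 ≤ N) :
    inner ℝ (hW.eigenvectorBasis i) (accGossip W c₂ c₃ x N).val
      = (1 - ((Polynomial.Chebyshev.T ℝ N).eval c₂)⁻¹
          * (Polynomial.Chebyshev.T ℝ N).eval (c₂ * (1 - c₃ * hW.eigenvalues i)))
        * inner ℝ (hW.eigenvectorBasis i) x := by
  obtain ⟨m, rfl⟩ := Nat.exists_eq_add_of_le' hN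
  have h : (accGossip W c₂ c₃ x (m + 1)).val
    = x - (chebLoop W c₂ c₃ x m).val.a⁻¹ • (chebLoop W c₂ c₃ x m).val.x := rfl
  obtain ⟨-, h2, -, h4⟩ := chebLoop_val hW c₂ c₃ x i m
  rw [h, inner_sub_right, real_inner_smul_right, h2, h4]
  push_cast
  ring

theorem eigenvalue_le_lambdaMax (hW : W.IsHermitian) (i : Fin n × Fin d) :
    hW.eigenvalues i ≤ lambdaMax W := by
  unfold lambdaMax
  rw [hW.spectrum_real_eq_range_eigenvalues]
  exact le_csSup (Set.finite_range _).bddAbove ⟨i, rfl⟩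

theorem lambdaMinPos_le_eigenvalue (hW : W.IsHermitian) {i : Fin n × Fin d}
    (hi : 0 < hW.eigenvalues i) : lambdaMinPos W ≤ hW.eigenvalues i := by
  unfold lambdaMinPos
  rw [hW.spectrum_real_eq_range_eigenvalues]
  exact csInf_le ⟨0, fun r hr => hr.2.le⟩ ⟨⟨i, rfl⟩, hi⟩

theorem exists_eigenvalue_pos (hW : W.PosSemidef) (hW0 : W ≠ 0) :
    ∃ i, 0 < hW.isHermitian.eigenvalues i := by
  by_contra! h
  apply hW0
  rw [← hW.isHermitian.eigenvalues_eq_zero_iff]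
  funext i
  exact le_antisymm (h i) (hW.eigenvalues_nonneg i)

theorem lambdaMinPos_pos (hW : W.PosSemidef) (hW0 : W ≠ 0) : 0 < lambdaMinPos W := by
  obtain ⟨i, hi⟩ := exists_eigenvalue_pos hW hW0
  have hfin : {r | r ∈ spectrum ℝ W ∧ 0 < r}.Finite := by
    rw [hW.isHermitian.spectrum_real_eq_range_eigenvalues]
    exact (Set.finite_range _).subset fun r hr => hr.1
  have hne : {r | r ∈ spectrum ℝ W ∧ 0 < r}.Nonempty := by
    rw [hW.isHermitian.spectrum_real_eq_range_eigenvalues]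
    exact ⟨_, ⟨i, rfl⟩, hi⟩
  exact (hne.csInf_mem hfin).2

theorem lambdaMinPos_le_lambdaMax (hW : W.PosSemidef) (hW0 : W ≠ 0) :
    lambdaMinPos W ≤ lambdaMax W := by
  obtain ⟨i, hi⟩ := exists_eigenvalue_pos hW hW0
  exact (lambdaMinPos_le_eigenvalue hW.isHermitian hi).trans
    (eigenvalue_le_lambdaMax hW.isHermitian i)

theorem one_le_chi (hW : W.PosSemidef) (hW0 : W ≠ 0) : 1 ≤ chi W :=
  (one_le_div (lambdaMinPos_pos hW hW0)).2 (lambdaMinPos_le_lambdaMax hW hW0)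

/-- Accelerated gossip is a symmetric linear map; it is bounded by `λ₁`, and it is bounded below by
`λ₂` on a subspace that contains its range and the range of `W`. -/
theorem exists_gossip_linearMap (hW : W.PosSemidef) (hW0 : W ≠ 0) (M : InnerMethod) (μ L : ℝ) :
    ∃ (K : Vec n d →ₗ[ℝ] Vec n d) (S : Submodule ℝ (Vec n d)),
      gossipMap W (apdaParams M μ L (chi W) (lambdaMax W)) = K ∧
      (∀ x y, inner ℝ (K x) y = inner ℝ x (K y)) ∧
      (∀ x, ‖K x‖ ≤ lambda₁ (chi W) * ‖x‖) ∧
      (∀ x ∈ S, lambda₂ (chi W) * ‖x‖ ≤ ‖K x‖) ∧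
      (∀ x, K x ∈ S) ∧
      LinearMap.range (Matrix.toEuclideanLin W) ≤ S := by
  have hH := hW.isHermitian
  set χ := chi W with hχdef
  have hχ : 1 ≤ χ := one_le_chi hW hW0
  have hmin := lambdaMinPos_pos hW hW0
  have hmax : 0 < lambdaMax W := hmin.trans_le (lambdaMinPos_le_lambdaMax hW hW0)
  set p := apdaParams M μ L χ (lambdaMax W) with hp
  set b := hH.eigenvectorBasis with hb
  set T := Polynomial.Chebyshev.T ℝ (gossipSteps χ) with hT
  set k : Fin n × Fin d → ℝ := fun i =>
    1 - (T.eval p.c₂)⁻¹ * T.eval (p.c₂ * (1 - p.c₃ * hH.eigenvalues i)) with hk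
  have hk0 : ∀ i, hH.eigenvalues i = 0 → k i = 0 := by
    intro i hi
    have h1 := (cheb_eigenvalue_bounds hχ hmax (l := lambdaMax W)
      (div_le_self hmax.le hχ) le_rfl).1
    have h2 : T.eval p.c₂ ≠ 0 := h1
    simp only [hk, hi, mul_zero, sub_zero, mul_one]
    rw [inv_mul_cancel₀ h2, sub_self]
  have hk1 : ∀ i, hH.eigenvalues i ≠ 0 → lambda₂ χ ≤ k i ∧ k i ≤ lambda₁ χ := by
    intro i hi
    have hpos : 0 < hH.eigenvalues i := lt_of_le_of_ne (hW.eigenvalues_nonneg i) hi.symm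
    have hle : lambdaMax W / χ ≤ hH.eigenvalues i := by
      have : lambdaMax W / χ = lambdaMinPos W := by
        rw [hχdef, chi, div_div_cancel₀ hmax.ne']
      rw [this]
      exact lambdaMinPos_le_eigenvalue hH hpos
    exact (cheb_eigenvalue_bounds hχ hmax hle (eigenvalue_le_lambdaMax hH i)).2
  have hinner : ∀ x i, inner ℝ (b i) (gossipMap W p x) = k i * inner ℝ (b i) x := by
    intro x i
    exact inner_accGossip hH p.c₂ p.c₃ x i (one_le_gossipSteps hχ)
  have hext : ∀ x y : Vec n d, (∀ i, inner ℝ (b i) x = inner ℝ (b i) y) → x = y := by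
    intro x y h
    apply b.repr.injective
    ext i
    rw [b.repr_apply_apply, b.repr_apply_apply, h i]
  have hnorm : ∀ x : Vec n d, ‖x‖ ^ 2 = ∑ i, inner ℝ (b i) x ^ 2 := by
    intro x
    rw [← b.sum_sq_norm_inner_right x]
    simp only [Real.norm_eq_abs, sq_abs]
  let K : Vec n d →ₗ[ℝ] Vec n d :=
    { toFun := gossipMap W p
      map_add' := fun x y => hext _ _ fun i => by
        simp only [hinner, inner_add_right]; ring
      map_smul' := fun c x => hext _ _ fun i => by
        simp only [hinner, real_inner_smul_right, RingHom.id_apply]; ring }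
  have hK : ∀ x i, inner ℝ (b i) (K x) = k i * inner ℝ (b i) x := hinner
  -- The span of the eigenvectors with nonzero eigenvalue, that is, the orthogonal complement of the
  -- kernel of `W`.
  let S : Submodule ℝ (Vec n d) :=
    { carrier := {x | ∀ i, hH.eigenvalues i = 0 → inner ℝ (b i) x = 0}
      add_mem' := fun {x y} hx hy i hi => by rw [inner_add_right, hx i hi, hy i hi, add_zero]
      zero_mem' := fun i _ => inner_zero_right _
      smul_mem' := fun c x hx i hi => by rw [real_inner_smul_right, hx i hi, mul_zero] }
  have hl1 := one_le_lambda₁ hχ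
  have hl2 := lambda₂_pos hχ
  refine ⟨K, S, rfl, ?_, ?_, ?_, ?_, ?_⟩
  · intro x y
    rw [← b.sum_inner_mul_inner, ← b.sum_inner_mul_inner x]
    refine Finset.sum_congr rfl fun i _ => ?_
    rw [real_inner_comm (b i) (K x), hK, hK, real_inner_comm (b i) x]
    ring
  · intro x
    refine le_of_abs_le (abs_le_of_sq_le_sq ?_ (by positivity))
    rw [mul_pow, hnorm, hnorm, Finset.mul_sum]
    refine Finset.sum_le_sum fun i _ => ?_
    rw [hK, mul_pow]
    refine mul_le_mul_of_nonneg_right ?_ (sq_nonneg _)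
    by_cases hi : hH.eigenvalues i = 0
    · rw [hk0 i hi, zero_pow two_ne_zero]; positivity
    · obtain ⟨h1, h2⟩ := hk1 i hi
      exact pow_le_pow_left₀ (hl2.le.trans h1) h2 2
  · intro x hx
    refine le_of_abs_le (abs_le_of_sq_le_sq ?_ (norm_nonneg _))
    rw [mul_pow, hnorm, hnorm, Finset.mul_sum]
    refine Finset.sum_le_sum fun i _ => ?_
    rw [hK, mul_pow]
    by_cases hi : hH.eigenvalues i = 0
    · rw [hx i hi]; simp
    · exact mul_le_mul_of_nonneg_right (pow_le_pow_left₀ hl2.le (hk1 i hi).1 2) (sq_nonneg _)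
  · intro x i hi
    rw [hK, hk0 i hi, zero_mul]
  · rintro _ ⟨x, rfl⟩ i hi
    rw [inner_eigenvectorBasis_mul, hi, zero_mul]

end Spectral

/-- The stacked gossip matrix is positive semidefinite. -/
theorem stackedGossip_posSemidef {n : ℕ} (d : ℕ) {G : SimpleGraph (Fin n)}
    {What : Matrix (Fin n) (Fin n) ℝ} (h : IsGossipMatrix G What) :
    (stackedGossip d What).PosSemidef :=
  h.posSemidef.kronecker Matrix.PosSemidef.one

theorem stackedGossip_ne_zero {n d : ℕ} (hd : 0 < d) {G : SimpleGraph (Fin n)}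
    (hG : G.Connected) {What : Matrix (Fin n) (Fin n) ℝ} (h : IsGossipMatrix G What) :
    stackedGossip d What ≠ 0 := by
  obtain ⟨i⟩ := hG.nonempty
  intro h0
  have h1 := (h.support i i).2 (Or.inl rfl)
  have h2 := congrFun (congrFun h0 (i, ⟨0, hd⟩)) (i, ⟨0, hd⟩)
  simp [stackedGossip] at h2
  exact h1 h2

/-! ### The objective and the auxiliary problems -/

section Objective

variable {n d : ℕ}

theorem differentiable_stackedObjective {f : Fin n → EuclideanSpace ℝ (Fin d) → ℝ}
    (hf : ∀ i, Differentiable ℝ (f i)) : Differentiable ℝ (stackedObjective f) := by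
  have hb : ∀ i, Differentiable ℝ fun x : Vec n d => block x i := by
    intro i
    rw [differentiable_euclidean]
    intro j
    exact differentiable_euclidean.1 differentiable_id (i, j)
  unfold stackedObjective
  exact Differentiable.fun_sum fun i _ => (hf i).comp (hb i)

/-- The descent lemma. -/
theorem descent_of_isLSmooth {P : Vec n d → ℝ} (hP : Differentiable ℝ P) {L : ℝ}
    (hL : IsLSmooth L P) (x y : Vec n d) :
    P y ≤ P x + inner ℝ (gradient P x) (y - x) + L / 2 * ‖y - x‖ ^ 2 := by
  set v := y - x with hv
  -- `P` minus the nonconstant part of its quadratic model along the segment; the Lipschitz bound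
  -- makes its derivative nonpositive on `(0, 1)`.
  let φ : ℝ → ℝ := fun t => P (x + t • v) - t * inner ℝ (gradient P x) v - L / 2 * t ^ 2 * ‖v‖ ^ 2
  have hd : ∀ t, HasDerivAt φ
      (inner ℝ (gradient P (x + t • v)) v - inner ℝ (gradient P x) v - L * t * ‖v‖ ^ 2) t := by
    intro t
    have h1 : HasDerivAt (fun t : ℝ => x + t • v) v t := by
      simpa using ((hasDerivAt_id t).smul_const v).const_add x
    have h2 : HasDerivAt (fun t : ℝ => P (x + t • v)) (inner ℝ (gradient P (x + t • v)) v) t := by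
      refine ((hP (x + t • v)).hasGradientAt.hasFDerivAt.comp_hasDerivAt t h1).congr_deriv ?_
      rw [InnerProductSpace.toDual_apply_apply]
    have h3 := (h2.sub ((hasDerivAt_id t).mul_const (inner ℝ (gradient P x) v))).sub
      (((hasDerivAt_pow 2 t).const_mul (L / 2)).mul_const (‖v‖ ^ 2))
    refine h3.congr_deriv ?_
    simp only [Nat.cast_ofNat, Nat.reduceSub, pow_one, one_mul]
    ring
  have hanti : AntitoneOn φ (Set.Icc 0 1) := by
    refine antitoneOn_of_deriv_nonpos (convex_Icc 0 1)
      (fun t _ => (hd t).continuousAt.continuousWithinAt)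
      (fun t _ => (hd t).differentiableAt.differentiableWithinAt) fun t ht => ?_
    rw [interior_Icc] at ht
    rw [(hd t).deriv, ← inner_sub_left]
    have h1 := real_inner_le_norm (gradient P (x + t • v) - gradient P x) v
    have h2 := hL (x + t • v) x
    rw [add_sub_cancel_left, norm_smul, Real.norm_eq_abs, abs_of_pos ht.1] at h2
    have h3 := mul_le_mul_of_nonneg_right h2 (norm_nonneg v)
    nlinarith
  have h := hanti (Set.left_mem_Icc.2 zero_le_one) (Set.right_mem_Icc.2 zero_le_one) zero_le_one
  simp only [φ, one_smul, zero_smul, add_zero, zero_mul, one_mul] at h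
  have e : x + v = y := by rw [hv]; abel
  rw [e] at h
  linarith

theorem IsStronglyConvex.convex {P : Vec n d → ℝ} {μ : ℝ} (hμ : 0 < μ)
    (h : IsStronglyConvex μ P) (x y : Vec n d) :
    P x + inner ℝ (gradient P x) (y - x) ≤ P y := by
  have h1 := h y x
  have : 0 ≤ μ / 2 * ‖y - x‖ ^ 2 := by positivity
  linarith

theorem IsStronglyConvex.le_inner {P : Vec n d → ℝ} {μ : ℝ}
    (h : IsStronglyConvex μ P) (x y : Vec n d) :
    μ * ‖x - y‖ ^ 2 ≤ inner ℝ (gradient P x - gradient P y) (x - y) := by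
  have h1 := h x y
  have h2 := h y x
  rw [norm_sub_rev, ← neg_sub x y, inner_neg_right] at h2
  rw [inner_sub_left]
  linarith

theorem IsStronglyConvex.le_of_isLSmooth {P : Vec n d → ℝ} {μ L : ℝ}
    (h : IsStronglyConvex μ P) (hL : IsLSmooth L P) {x y : Vec n d} (hxy : x ≠ y) : μ ≤ L := by
  have h1 := h.le_inner x y
  have h2 := real_inner_le_norm (gradient P x - gradient P y) (x - y)
  have h3 := mul_le_mul_of_nonneg_right (hL x y) (norm_nonneg (x - y))
  have h4 : 0 < ‖x - y‖ := norm_pos_iff.2 (sub_ne_zero.2 hxy)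
  have h5 : μ * ‖x - y‖ ^ 2 ≤ L * ‖x - y‖ ^ 2 := by nlinarith
  exact le_of_mul_le_mul_right h5 (by positivity)

end Objective

/-! ### Linear and proximal perturbations of a smooth convex function -/

section Perturbation

variable {E : Type} [NormedAddCommGroup E] [InnerProductSpace ℝ E]

/-- A gradient step from `w` would otherwise decrease `f` strictly, by `step_le`. -/
theorem SmoothConvex.grad_eq_zero {L : ℝ} (hL : 0 < L) {f : E → ℝ} {g : E → E}
    (h : SmoothConvex L f g) {w : E} (hw : ∀ z, f w ≤ f z) : g w = 0 := by
  have h1 := h.step_le hL w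
  have h2 := hw (w - (1 / L) • g w)
  have h3 : 0 ≤ 1 / (2 * L) * ‖g (w - (1 / L) • g w)‖ ^ 2 := by positivity
  have h4 : 1 / (2 * L) * ‖g w‖ ^ 2 ≤ 0 := by linarith
  have h5 : 0 < 1 / (2 * L) := by positivity
  have h6 : ‖g w‖ ^ 2 = 0 := le_antisymm (nonpos_of_mul_nonpos_right h4 h5) (sq_nonneg _)
  exact norm_eq_zero.1 (pow_eq_zero_iff two_ne_zero |>.1 h6)

theorem SmoothConvex.add_linear {L : ℝ} {f : E → ℝ} {g : E → E}
    (h : SmoothConvex L f g) (c : E) :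
    SmoothConvex L (fun z => f z + inner ℝ c z) (fun z => g z + c) := by
  intro x y
  have h1 := h x y
  simp only [add_sub_add_right_eq_sub]
  rw [inner_add_left, inner_sub_right c]
  linarith

theorem smoothConvex_add_prox {L : ℝ} {f : E → ℝ} {g : E → E}
    (hc : ∀ x y, f x + inner ℝ (g x) (y - x) ≤ f y)
    (hs : ∀ x y, f y ≤ f x + inner ℝ (g x) (y - x) + L / 2 * ‖y - x‖ ^ 2) {h : ℝ} (hL : 0 < L) (hh : 0 < h) (c : E) :
    SmoothConvex (L + 1 / h) (fun z => f z + 1 / (2 * h) * ‖z - c‖ ^ 2)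
      (fun z => g z + (1 / h) • (z - c)) := by
  have key : ∀ x y : E, 1 / (2 * h) * ‖y - c‖ ^ 2 = 1 / (2 * h) * ‖x - c‖ ^ 2
      + inner ℝ ((1 / h) • (x - c)) (y - x) + 1 / h / 2 * ‖y - x‖ ^ 2 := by
    intro x y
    have : y - c = (x - c) + (y - x) := by abel
    rw [this, norm_add_sq_real, real_inner_smul_left]
    field_simp
  refine smoothConvex_of_bounds (by positivity) (fun x y => ?_) fun x y => ?_
  · have h1 := hc x y
    have : 0 ≤ 1 / h / 2 * ‖y - x‖ ^ 2 := by positivity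
    rw [key x y, inner_add_left]
    linarith
  · have h1 := hs x y
    rw [key x y, inner_add_left]
    linarith

/-- Outside the ball of radius `2h‖g c‖` around `c`, the quadratic outweighs the slope of the
supporting plane at `c`, so the value there is at least that at `c`; continuity and compactness do
the rest. -/
theorem exists_prox_minimizer [FiniteDimensional ℝ E] {f : E → ℝ} {g : E → E}
    (hc : ∀ x y, f x + inner ℝ (g x) (y - x) ≤ f y) (hf : Continuous f) {h : ℝ} (hh : 0 < h)
    (c : E) : ∃ w, ∀ z, f w + 1 / (2 * h) * ‖w - c‖ ^ 2 ≤ f z + 1 / (2 * h) * ‖z - c‖ ^ 2 := by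
  have : ProperSpace E := FiniteDimensional.proper ℝ E
  refine Continuous.exists_forall_le' (f := fun z => f z + 1 / (2 * h) * ‖z - c‖ ^ 2)
    (by fun_prop) c ?_
  filter_upwards [(isCompact_closedBall c (2 * h * ‖g c‖)).compl_mem_cocompact] with z hz
  rw [Set.mem_compl_iff, Metric.mem_closedBall, not_le, dist_eq_norm] at hz
  have h1 := hc c z
  have h2 := abs_le.1 (abs_real_inner_le_norm (g c) (z - c))
  have h3 : ‖g c‖ * ‖z - c‖ ≤ 1 / (2 * h) * ‖z - c‖ ^ 2 := by
    have h4 : ‖g c‖ ≤ 1 / (2 * h) * ‖z - c‖ := by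
      rw [one_div, ← div_eq_inv_mul, le_div_iff₀ (by positivity)]; linarith
    calc ‖g c‖ * ‖z - c‖ ≤ 1 / (2 * h) * ‖z - c‖ * ‖z - c‖ := by gcongr
      _ = _ := by ring
  simp only [sub_self, norm_zero]
  linarith [h2.1]

end Perturbation

/-! ### One iteration of the primal-dual method -/

section Step

variable {E : Type} [NormedAddCommGroup E] [InnerProductSpace ℝ E]

/-- A three-point identity for a step along `u`. With `z` the approximate prox, `‖x - h • u - z‖²`
is the inexactness, to be paid by `-‖x - z‖²`. -/
theorem norm_sub_smul_sub_sq (x z s u : E) (h : ℝ) :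
    ‖x - h • u - s‖ ^ 2 = ‖x - s‖ ^ 2 - 2 * h * inner ℝ u (z - s) + ‖x - h • u - z‖ ^ 2
      - ‖x - z‖ ^ 2 := by
  have e1 : x - h • u - s = (x - s) - h • u := by abel
  have e2 : x - h • u - z = (x - z) - h • u := by abel
  have e3 : z - s = (x - s) - (x - z) := by abel
  rw [e1, e2, e3, norm_sub_sq_real (x - s), norm_sub_sq_real (x - z), real_inner_smul_right,
    real_inner_smul_right, inner_sub_right u, real_inner_comm u (x - s),
    real_inner_comm u (x - z)]
  ring

theorem norm_add_sub_sq (y D s : E) :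
    ‖y + D - s‖ ^ 2 = ‖y - s‖ ^ 2 + 2 * inner ℝ D (y + D - s) - ‖D‖ ^ 2 := by
  have e1 : y + D - s = (y - s) + D := by abel
  rw [e1, norm_add_sq_real, inner_add_right, real_inner_self_eq_norm_sq, real_inner_comm D]
  ring

/-- The two sides differ by `‖u + v + w‖²`. -/
theorem neg_two_inner_add_le (u v w : E) :
    -2 * inner ℝ (u + v) (u + w) ≤ -‖u‖ ^ 2 + ‖v‖ ^ 2 + ‖w‖ ^ 2 := by
  have h := sq_nonneg ‖u + v + w‖
  rw [norm_add_sq_real, norm_add_sq_real, inner_add_left] at h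
  simp only [inner_add_left, inner_add_right, real_inner_self_eq_norm_sq]
  rw [real_inner_comm u v]
  linarith

theorem norm_add_sq_le_of_pos {E : Type} [NormedAddCommGroup E] (a b : E) {τ σ : ℝ}
    (hτ : 0 < τ) (hσ : τ * σ = 1) : ‖a + b‖ ^ 2 ≤ (1 + τ) * ‖a‖ ^ 2 + (1 + σ) * ‖b‖ ^ 2 := by
  have h1 := norm_add_le a b
  have h2 : ‖a + b‖ ^ 2 ≤ (‖a‖ + ‖b‖) ^ 2 := by gcongr
  have h3 : 2 * ‖a‖ * ‖b‖ ≤ τ * ‖a‖ ^ 2 + σ * ‖b‖ ^ 2 := by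
    have hσ' : σ = 1 / τ := by rw [eq_div_iff hτ.ne']; linarith
    rw [hσ']
    have := mul_nonneg (one_div_pos.2 hτ).le (sq_nonneg (τ * ‖a‖ - ‖b‖))
    have e : 1 / τ * (τ * ‖a‖ - ‖b‖) ^ 2
      = τ * ‖a‖ ^ 2 + 1 / τ * ‖b‖ ^ 2 - 2 * ‖a‖ * ‖b‖ := by field_simp; ring
    linarith
  nlinarith

/-- Young's inequality, weighted so that the first square is exactly the `1 / (2e)` term available
in the Lyapunov function. -/
theorem two_mul_inner_le (K : E →ₗ[ℝ] E) {l₁ e : ℝ} (he : 0 < e)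
    (hK : ∀ x, ‖K x‖ ≤ l₁ * ‖x‖) (a b : E) :
    2 * |inner ℝ (K a) b| ≤ 1 / (2 * e) * ‖a‖ ^ 2 + 2 * e * l₁ ^ 2 * ‖b‖ ^ 2 := by
  have h1 := abs_real_inner_le_norm (K a) b
  have h2 := mul_le_mul_of_nonneg_right (hK a) (norm_nonneg b)
  have h3 := mul_nonneg (show 0 ≤ 1 / (2 * e) by positivity)
    (sq_nonneg (‖a‖ - 2 * e * l₁ * ‖b‖))
  have e1 : 1 / (2 * e) * (‖a‖ - 2 * e * l₁ * ‖b‖) ^ 2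
    = 1 / (2 * e) * ‖a‖ ^ 2 + 2 * e * l₁ ^ 2 * ‖b‖ ^ 2 - 2 * (l₁ * ‖a‖ * ‖b‖) := by
    field_simp; ring
  linarith

/-- The primal step yields `-2⟨g - gs, xh - xs⟩`. One copy is spent on strong monotonicity, which
provides the factor `1 + μh/2`, the other on cocoercivity. Since `gs = -K ys`, the dual correction
is governed by `u + v` with `u = K(y - ys)`, `v = g - gs`: here `-β‖u‖²` contracts the dual error,
`β‖v‖²` is paid by cocoercivity, and `β‖w‖²` by half of `‖y' - y‖² / e`. -/
theorem primalDual_step (K : E →ₗ[ℝ] E) (hsymm : ∀ x y, inner ℝ (K x) y = inner ℝ x (K y))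
    {μ L h e β l₁ l₂ : ℝ} (hμ : 0 < μ) (hh : 0 < h) (he : 0 < e) (hβ : 0 ≤ β)
    (hl₂ : 0 ≤ l₂) (hK : ∀ x, ‖K x‖ ≤ l₁ * ‖x‖) (hβL : β ≤ 1 / L)
    (hβe : 2 * β * l₁ ^ 2 * e ≤ 1) {x xs xh y ys ybar g gs x' y' : E}
    (hxs : K xs = 0) (hgs : gs + K ys = 0)
    (hmono : μ * ‖xh - xs‖ ^ 2 ≤ inner ℝ (g - gs) (xh - xs))
    (hcoc : 1 / L * ‖g - gs‖ ^ 2 ≤ inner ℝ (g - gs) (xh - xs))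
    (hys : l₂ * ‖y - ys‖ ≤ ‖K (y - ys)‖)
    (hx' : x' = x - h • (g + K ybar)) (hy' : y' = y + e • (K xh - β • K (K y + g))) :
    (1 + μ * h / 2) * (1 / h) * ‖x' - xs‖ ^ 2 + 1 / e * ‖y' - ys‖ ^ 2
        + 1 / (2 * e) * ‖y' - y‖ ^ 2 + 2 * inner ℝ (K (ybar - y')) (xh - xs)
      ≤ 1 / h * ‖x - xs‖ ^ 2 + (1 - l₂ ^ 2 * β * e) * (1 / e) * ‖y - ys‖ ^ 2
        + (1 + μ * h) * (1 / h) * ‖x' - xh‖ ^ 2 - 1 / h * ‖x - xh‖ ^ 2 := by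
  have hgs' : gs = -K ys := eq_neg_of_add_eq_zero_left hgs
  -- the primal part
  have p1 := norm_sub_smul_sub_sq x xh xs (g + K ybar) h
  rw [← hx'] at p1
  have p2 : inner ℝ (g + K ybar) (xh - xs)
      = inner ℝ (g - gs) (xh - xs) + inner ℝ (K (ybar - ys)) (xh - xs) := by
    rw [← inner_add_left, map_sub, hgs']
    congr 1
    abel
  rw [p2] at p1
  have p3 : ‖x' - xs‖ ^ 2 ≤ 2 * ‖xh - xs‖ ^ 2 + 2 * ‖x' - xh‖ ^ 2 := by
    have := norm_add_sq_le_of_pos (xh - xs) (x' - xh) one_pos (one_mul 1)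
    rw [show xh - xs + (x' - xh) = x' - xs by abel] at this
    linarith
  set I := inner ℝ (g - gs) (xh - xs)
  set J := inner ℝ (K (ybar - ys)) (xh - xs)
  have p4 : 1 / h * ‖x' - xs‖ ^ 2 = 1 / h * ‖x - xs‖ ^ 2 - 2 * (I + J) + 1 / h * ‖x' - xh‖ ^ 2
      - 1 / h * ‖x - xh‖ ^ 2 := by
    rw [p1]; field_simp
  have p5 : (1 + μ * h / 2) * (1 / h) * ‖x' - xs‖ ^ 2
      = 1 / h * ‖x' - xs‖ ^ 2 + μ / 2 * ‖x' - xs‖ ^ 2 := by field_simp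
  have p6 : (1 + μ * h) * (1 / h) * ‖x' - xh‖ ^ 2
      = 1 / h * ‖x' - xh‖ ^ 2 + μ * ‖x' - xh‖ ^ 2 := by field_simp
  have p7 := mul_le_mul_of_nonneg_left p3 (show 0 ≤ μ / 2 by positivity)
  -- the dual part
  set u := K (y - ys) with hu
  set v := g - gs with hv
  set w := K (y' - y) with hw
  have q0 : K y + g = u + v := by rw [hu, hv, hgs', map_sub]; abel
  have q1 := norm_add_sub_sq y (e • (K xh - β • K (K y + g))) ys
  rw [← hy'] at q1
  have q2 : y' - y = e • (K xh - β • K (K y + g)) := by rw [hy']; abel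
  rw [← q2] at q1
  have q3 : inner ℝ (y' - y) (y' - ys)
      = e * (inner ℝ (K (y' - ys)) (xh - xs) - β * inner ℝ (u + v) (u + w)) := by
    have e1 : K (y' - ys) = u + w := by rw [hu, hw, ← map_add]; congr 1; abel
    rw [q2, q0, real_inner_smul_left, inner_sub_left, real_inner_smul_left, hsymm (u + v), ← e1,
      hsymm (y' - ys), map_sub K xh, hxs, sub_zero, real_inner_comm (y' - ys)]
  have q4 := mul_le_mul_of_nonneg_left (neg_two_inner_add_le u v w) hβ
  have q5 : ‖w‖ ^ 2 ≤ l₁ ^ 2 * ‖y' - y‖ ^ 2 := by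
    rw [← mul_pow]; exact pow_le_pow_left₀ (norm_nonneg _) (hK _) 2
  have q6 : (l₂ * ‖y - ys‖) ^ 2 ≤ ‖u‖ ^ 2 := pow_le_pow_left₀ (by positivity) hys 2
  have q7 : β * ‖v‖ ^ 2 ≤ 1 / L * ‖v‖ ^ 2 := by gcongr
  have q8 : β * ‖w‖ ^ 2 ≤ 1 / (2 * e) * ‖y' - y‖ ^ 2 := by
    have h1 : β * l₁ ^ 2 ≤ 1 / (2 * e) := by
      rw [le_div_iff₀ (by positivity)]; linarith
    calc β * ‖w‖ ^ 2 ≤ β * (l₁ ^ 2 * ‖y' - y‖ ^ 2) := by gcongr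
      _ = β * l₁ ^ 2 * ‖y' - y‖ ^ 2 := by ring
      _ ≤ _ := by gcongr
  have q9 : β * (l₂ * ‖y - ys‖) ^ 2 ≤ β * ‖u‖ ^ 2 := by gcongr
  have q10 : 1 / e * ‖y' - ys‖ ^ 2 = 1 / e * ‖y - ys‖ ^ 2
      + 2 * inner ℝ (K (y' - ys)) (xh - xs) + β * (-2 * inner ℝ (u + v) (u + w))
      - 1 / e * ‖y' - y‖ ^ 2 := by
    rw [q1, q3]; field_simp; ring
  have q11 : (1 - l₂ ^ 2 * β * e) * (1 / e) * ‖y - ys‖ ^ 2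
      = 1 / e * ‖y - ys‖ ^ 2 - β * (l₂ * ‖y - ys‖) ^ 2 := by field_simp
  have q12 : 1 / e * ‖y' - y‖ ^ 2 = 2 * (1 / (2 * e) * ‖y' - y‖ ^ 2) := by ring
  have r : inner ℝ (K (ybar - y')) (xh - xs) = J - inner ℝ (K (y' - ys)) (xh - xs) := by
    rw [← inner_sub_left, ← map_sub]; congr 2; abel
  rw [r, p5, p6, q11, p4, q10]
  linarith

/-- The value of the Lyapunov function in terms of the last two dual iterates. -/
noncomputable def lyapunovValue (K : E →ₗ[ℝ] E) (μ h e : ℝ) (xs ys x y yp xh : E) (D : ℝ) : ℝ :=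
  (1 + μ * h / 2) * (1 / h) * ‖x - xs‖ ^ 2 + 1 / e * ‖y - ys‖ ^ 2
    + 1 / (2 * e) * ‖y - yp‖ ^ 2 + 1 / (8 * h) * D - 2 * inner ℝ (K y - K yp) (xh - xs)

/-- Young's inequality absorbs the coupling term. The split with weights `7/5` and `7/2` works
because `0.7072 · 7/5 < 1` and `0.7072 · 7/2 · 1/64 < 1/8`. -/
theorem lyapunovValue_nonneg (K : E →ₗ[ℝ] E) {μ h e l₁ : ℝ} (hμ : 0 < μ) (hh : 0 < h)
    (he : 0 < e) (hK : ∀ x, ‖K x‖ ≤ l₁ * ‖x‖) (hhe : 2 * e * l₁ ^ 2 ≤ 0.7072 * (1 / h))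
    (xs ys : E) {x y yp xh : E} {D : ℝ} (hD : ‖x - xh‖ ^ 2 ≤ D / 64) :
    0 ≤ lyapunovValue K μ h e xs ys x y yp xh D := by
  unfold lyapunovValue
  have h1 := two_mul_inner_le K he hK (y - yp) (xh - xs)
  rw [map_sub] at h1
  have h2 := le_abs_self (inner ℝ (K y - K yp) (xh - xs))
  have h3 := norm_add_sq_le_of_pos (x - xs) (xh - x) (τ := 2 / 5) (σ := 5 / 2) (by norm_num)
    (by norm_num)
  rw [show x - xs + (xh - x) = xh - xs by abel, norm_sub_rev xh x] at h3
  have h4 : 2 * e * l₁ ^ 2 * ‖xh - xs‖ ^ 2 ≤ 0.7072 * (1 / h) * ‖xh - xs‖ ^ 2 := by gcongr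
  have h5 : 0.7072 * (1 / h) * ‖xh - xs‖ ^ 2 ≤ 1 / h * (‖x - xs‖ ^ 2 + D / 8) := by
    rw [mul_comm (0.7072 : ℝ), mul_assoc]
    refine mul_le_mul_of_nonneg_left ?_ (by positivity)
    linarith [sq_nonneg ‖x - xs‖, sq_nonneg ‖x - xh‖]
  have h6 : 0 ≤ μ / 2 * ‖x - xs‖ ^ 2 := by positivity
  have h7 : (1 + μ * h / 2) * (1 / h) * ‖x - xs‖ ^ 2
      = 1 / h * ‖x - xs‖ ^ 2 + μ / 2 * ‖x - xs‖ ^ 2 := by field_simp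
  have h8 : 1 / (8 * h) * D = 1 / h * (D / 8) := by field_simp
  have h9 : 0 ≤ 1 / e * ‖y - ys‖ ^ 2 := by positivity
  rw [h7, h8]
  rw [mul_add] at h5
  linarith

theorem lyapunovValue_step (K : E →ₗ[ℝ] E) (hsymm : ∀ x y, inner ℝ (K x) y = inner ℝ x (K y))
    {μ L h e β l₁ l₂ θ : ℝ} (hμ : 0 < μ) (hh : 0 < h) (he : 0 < e) (hβ : 0 ≤ β)
    (hl₂ : 0 ≤ l₂) (hK : ∀ x, ‖K x‖ ≤ l₁ * ‖x‖) (hβL : β ≤ 1 / L)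
    (hβe : 2 * β * l₁ ^ 2 * e ≤ 1) (hhe : 2 * e * l₁ ^ 2 ≤ 0.7072 * (1 / h))
    (hμh : μ * h ≤ 1 / 2) (hθ : 2 / (2 + μ * h) ≤ θ) (hθ' : 1 - l₂ ^ 2 * β * e ≤ θ) (hθ1 : θ ≤ 1)
    {x xs xh w y ys yp xhp ybar g gs x' y' : E} {D : ℝ}
    (hxs : K xs = 0) (hgs : gs + K ys = 0)
    (hmono : μ * ‖xh - xs‖ ^ 2 ≤ inner ℝ (g - gs) (xh - xs))
    (hcoc : 1 / L * ‖g - gs‖ ^ 2 ≤ inner ℝ (g - gs) (xh - xs))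
    (hys : l₂ * ‖y - ys‖ ≤ ‖K (y - ys)‖) (hybar : ybar = y + θ • (y - yp))
    (hx' : x' = x - h • (g + K ybar)) (hy' : y' = y + e • (K xh - β • K (K y + g)))
    (hD : ‖x - xhp‖ ^ 2 ≤ D / 64) (hx'xh : ‖x' - xh‖ ^ 2 ≤ ‖x - w‖ ^ 2 / 64)
    (hxhw : ‖xh - w‖ ^ 2 ≤ ‖x - w‖ ^ 2 / 64) :
    lyapunovValue K μ h e xs ys x' y' y xh (‖x - w‖ ^ 2)
      ≤ θ * lyapunovValue K μ h e xs ys x y yp xhp D := by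
  have hθ0 : 0 < θ := lt_of_lt_of_le (by positivity) hθ
  have main := primalDual_step K hsymm hμ hh he hβ hl₂ hK hβL hβe hxs hgs hmono hcoc hys hx' hy'
  -- Extrapolation produces the new coupling term and exactly `θ` times the old one; the defect is
  -- the change of approximate prox, `xh - xhp`.
  have c1 : inner ℝ (K (ybar - y')) (xh - xs)
      = -inner ℝ (K y' - K y) (xh - xs) + θ * inner ℝ (K y - K yp) (xhp - xs)
        + θ * inner ℝ (K (y - yp)) (xh - xhp) := by
    have e1 : K (ybar - y') = θ • (K y - K yp) - (K y' - K y) := by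
      rw [hybar, map_sub, map_add, map_smul, map_sub]; abel
    have e2 : xh - xs = (xhp - xs) + (xh - xhp) := by abel
    rw [e1, inner_sub_left, real_inner_smul_left, map_sub]
    nth_rewrite 1 [e2]
    rw [inner_add_right (K y - K yp)]
    ring
  have c2 := two_mul_inner_le K he hK (y - yp) (xh - xhp)
  have c3 := neg_abs_le (inner ℝ (K (y - yp)) (xh - xhp))
  -- The weights give `0.7072 · 9/8 = 0.7956` for the current error and `0.7072 · 9/64 < 1/8` for
  -- the previous one, which is what `D` can pay.
  have c4 := norm_add_sq_le_of_pos (xh - x) (x - xhp) (τ := 1 / 8) (σ := 8) (by norm_num)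
    (by norm_num)
  rw [show xh - x + (x - xhp) = xh - xhp by abel, norm_sub_rev xh x] at c4
  have c5 := norm_add_sq_le_of_pos (x - xh) (xh - w) (τ := 1 / 7) (σ := 7) (by norm_num)
    (by norm_num)
  rw [show x - xh + (xh - w) = x - w by abel] at c5
  have c6 : 2 * e * l₁ ^ 2 * ‖xh - xhp‖ ^ 2 ≤ 0.7072 * (1 / h) * ‖xh - xhp‖ ^ 2 := by gcongr
  have c7 : -(θ * inner ℝ (K (y - yp)) (xh - xhp)) * 2
      ≤ θ * (1 / (2 * e) * ‖y - yp‖ ^ 2) + θ * (0.7072 * (1 / h) * ‖xh - xhp‖ ^ 2) := by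
    have : -inner ℝ (K (y - yp)) (xh - xhp) * 2
      ≤ 1 / (2 * e) * ‖y - yp‖ ^ 2 + 0.7072 * (1 / h) * ‖xh - xhp‖ ^ 2 := by linarith
    have := mul_le_mul_of_nonneg_left this hθ0.le
    linarith
  have hD0 : 0 ≤ D := by linarith [sq_nonneg ‖x - xhp‖]
  have c8 : 0.7072 * ‖xh - xhp‖ ^ 2 ≤ 0.7956 * ‖x - xh‖ ^ 2 + D / 8 := by
    linarith [sq_nonneg ‖x - xh‖]
  have c9 : θ * (0.7072 * (1 / h) * ‖xh - xhp‖ ^ 2)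
      ≤ 1 / h * (0.7956 * ‖x - xh‖ ^ 2) + θ * (1 / (8 * h) * D) := by
    have e1 : θ * (0.7072 * ‖xh - xhp‖ ^ 2) ≤ 0.7956 * ‖x - xh‖ ^ 2 + θ * (D / 8) := by
      have e3 := mul_le_mul_of_nonneg_left c8 hθ0.le
      have e4 := mul_le_mul_of_nonneg_right hθ1
        (show 0 ≤ 0.7956 * ‖x - xh‖ ^ 2 by positivity)
      linarith
    have e2 := mul_le_mul_of_nonneg_left e1 (one_div_pos.2 hh).le
    refine le_trans (le_of_eq ?_) (e2.trans (le_of_eq ?_))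
    · ring
    · field_simp
  -- The budget closes: `c5` and the accuracy of `xh` give `‖x - w‖² ≤ (64/49) ‖x - xh‖²`, and
  -- `0.7956 + (3/128 + 1/8) · 64/49 < 1`.
  have c10 : (1 + μ * h) * (1 / h) * ‖x' - xh‖ ^ 2 + 1 / h * (0.7956 * ‖x - xh‖ ^ 2)
      + 1 / (8 * h) * ‖x - w‖ ^ 2 ≤ 1 / h * ‖x - xh‖ ^ 2 := by
    have e1 : (1 + μ * h) * ‖x' - xh‖ ^ 2 + 0.7956 * ‖x - xh‖ ^ 2 + ‖x - w‖ ^ 2 / 8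
        ≤ ‖x - xh‖ ^ 2 := by
      have : (1 + μ * h) * ‖x' - xh‖ ^ 2 ≤ 3 / 2 * (‖x - w‖ ^ 2 / 64) := by
        gcongr; linarith
      linarith [sq_nonneg ‖x - xh‖, sq_nonneg ‖x - w‖]
    have e2 := mul_le_mul_of_nonneg_left e1 (one_div_pos.2 hh).le
    refine le_trans (le_of_eq ?_) e2
    field_simp
  have c11 : 1 / h * ‖x - xs‖ ^ 2 ≤ θ * ((1 + μ * h / 2) * (1 / h) * ‖x - xs‖ ^ 2) := by
    have e1 : 1 ≤ θ * (1 + μ * h / 2) := by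
      rw [div_le_iff₀ (by positivity)] at hθ
      linarith
    calc 1 / h * ‖x - xs‖ ^ 2 = 1 * (1 / h * ‖x - xs‖ ^ 2) := by ring
      _ ≤ θ * (1 + μ * h / 2) * (1 / h * ‖x - xs‖ ^ 2) := by gcongr
      _ = _ := by ring
  have c12 : (1 - l₂ ^ 2 * β * e) * (1 / e) * ‖y - ys‖ ^ 2 ≤ θ * (1 / e * ‖y - ys‖ ^ 2) := by
    rw [mul_assoc]; gcongr
  rw [c1] at main
  unfold lyapunovValue
  rw [mul_sub, mul_add, mul_add, mul_add]
  linarith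

end Step

/-! ### The parameters -/

section Parameters

theorem one_le_sqrt_div {μ L : ℝ} (hμ : 0 < μ) (hμL : μ ≤ L) : 1 ≤ √(L / μ) :=
  Real.one_le_sqrt.2 ((one_le_div hμ).2 hμL)

theorem sqrt_mul_eq {μ L : ℝ} (hμ : 0 < μ) : √(L * μ) = μ * √(L / μ) := by
  have : L * μ = μ ^ 2 * (L / μ) := by field_simp
  rw [this, Real.sqrt_mul (by positivity), Real.sqrt_sq hμ.le]

theorem eq_mul_sqrt_div_sq {μ L : ℝ} (hμ : 0 < μ) (hL : 0 ≤ L) : L = μ * √(L / μ) ^ 2 := by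
  rw [Real.sq_sqrt (by positivity)]; field_simp

variable (M : InnerMethod) {μ L χ : ℝ} (lmax : ℝ)

theorem etaX_eq (hμ : 0 < μ) : (apdaParams M μ L χ lmax).etaX
    = lambda₂ χ / lambda₁ χ / (2 * (μ * √(L / μ))) := by
  simp only [apdaParams, sqrt_mul_eq hμ]
  ring

theorem etaY_eq (hμ : 0 < μ) : (apdaParams M μ L χ lmax).etaY
    = μ * √(L / μ) / (√2 * lambda₁ χ * lambda₂ χ) := by
  simp only [apdaParams, sqrt_mul_eq hμ]

theorem etaX_pos (hμ : 0 < μ) (hμL : μ ≤ L) (hχ : 1 ≤ χ) :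
    0 < (apdaParams M μ L χ lmax).etaX := by
  have h1 := one_le_sqrt_div hμ hμL
  have h2 := lambda_ratio_ge hχ
  rw [etaX_eq M lmax hμ]
  exact div_pos (by linarith) (by positivity)

theorem etaY_pos (hμ : 0 < μ) (hμL : μ ≤ L) (hχ : 1 ≤ χ) :
    0 < (apdaParams M μ L χ lmax).etaY := by
  have h1 := one_le_sqrt_div hμ hμL
  have h2 := one_le_lambda₁ hχ
  have h3 := lambda₂_pos hχ
  rw [etaY_eq M lmax hμ]
  positivity

theorem betaY_nonneg (hμ : 0 < μ) (hμL : μ ≤ L) (hχ : 1 ≤ χ) :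
    0 ≤ (apdaParams M μ L χ lmax).betaY := by
  have h1 := etaY_pos M lmax hμ hμL hχ
  have hL : 0 < L := hμ.trans_le hμL
  refine le_min (by positivity) ?_
  change 0 ≤ 1 / (2 * lambda₁ χ ^ 2 * (apdaParams M μ L χ lmax).etaY)
  positivity

theorem betaY_mul_le (hμ : 0 < μ) (hμL : μ ≤ L) (hχ : 1 ≤ χ) :
    2 * (apdaParams M μ L χ lmax).betaY * lambda₁ χ ^ 2 * (apdaParams M μ L χ lmax).etaY ≤ 1 := by
  have h1 := etaY_pos M lmax hμ hμL hχ
  have h2 := one_le_lambda₁ hχ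
  have h3 : (apdaParams M μ L χ lmax).betaY
    ≤ 1 / (2 * lambda₁ χ ^ 2 * (apdaParams M μ L χ lmax).etaY) := min_le_right _ _
  rw [le_div_iff₀ (by positivity)] at h3
  linarith

/-- The left side equals `1 / (√2 η_x)`; `0.7072` is a rational upper bound for `1 / √2`. -/
theorem etaY_mul_le (hμ : 0 < μ) (hμL : μ ≤ L) (hχ : 1 ≤ χ) :
    2 * (apdaParams M μ L χ lmax).etaY * lambda₁ χ ^ 2
      ≤ 0.7072 * (1 / (apdaParams M μ L χ lmax).etaX) := by
  have h1 := one_le_sqrt_div hμ hμL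
  have h2 := one_le_lambda₁ hχ
  have h3 := lambda₂_pos hχ
  rw [etaX_eq M lmax hμ, etaY_eq M lmax hμ]
  have h4 : √2 ≤ 1.4144 := Real.sqrt_le_iff.2 ⟨by norm_num, by norm_num⟩
  have e1 : 2 * (μ * √(L / μ) / (√2 * lambda₁ χ * lambda₂ χ)) * lambda₁ χ ^ 2
      = √2 * (μ * √(L / μ) * (lambda₁ χ / lambda₂ χ)) := by
    field_simp
    rw [Real.sq_sqrt (by norm_num)]
  have e2 : 0.7072 * (1 / (lambda₂ χ / lambda₁ χ / (2 * (μ * √(L / μ)))))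
      = 1.4144 * (μ * √(L / μ) * (lambda₁ χ / lambda₂ χ)) := by
    field_simp
    norm_num
  rw [e1, e2]
  gcongr

theorem mul_etaX_eq (hμ : 0 < μ) : μ * (apdaParams M μ L χ lmax).etaX
    = lambda₂ χ / lambda₁ χ / (2 * √(L / μ)) := by
  rw [etaX_eq M lmax hμ]
  by_cases h : √(L / μ) = 0
  · simp [h]
  · field_simp

theorem mul_etaX_le (hμ : 0 < μ) (hμL : μ ≤ L) (hχ : 1 ≤ χ) :
    μ * (apdaParams M μ L χ lmax).etaX ≤ 1 / 2 := by
  have h1 := one_le_sqrt_div hμ hμL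
  have h2 := lambda_ratio_le hχ
  rw [mul_etaX_eq M lmax hμ, div_le_div_iff₀ (by positivity) (by norm_num)]
  linarith

theorem mul_etaX_ge (hμ : 0 < μ) (hμL : μ ≤ L) (hχ : 1 ≤ χ) :
    1 / (32 * √(L / μ)) ≤ μ * (apdaParams M μ L χ lmax).etaX := by
  have h1 := one_le_sqrt_div hμ hμL
  have h2 := lambda_ratio_ge hχ
  rw [mul_etaX_eq M lmax hμ, div_le_div_iff₀ (by positivity) (by positivity)]
  nlinarith

/-- The product is at most `1 + √κ / 2`, and `√κ ≥ 1`. -/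
theorem etaX_mul_smooth_le (hμ : 0 < μ) (hμL : μ ≤ L) (hχ : 1 ≤ χ) :
    (apdaParams M μ L χ lmax).etaX * (L + 1 / (apdaParams M μ L χ lmax).etaX)
      ≤ 3 / 4 * (1 + √(L / μ)) := by
  have h1 := one_le_sqrt_div hμ hμL
  have h2 := lambda_ratio_le hχ
  have h3 := etaX_pos M lmax hμ hμL hχ
  have hL := eq_mul_sqrt_div_sq hμ (hμ.le.trans hμL)
  have e : (apdaParams M μ L χ lmax).etaX * L = lambda₂ χ / lambda₁ χ * √(L / μ) / 2 := by
    calc (apdaParams M μ L χ lmax).etaX * L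
        = (apdaParams M μ L χ lmax).etaX * (μ * √(L / μ) ^ 2) := by rw [← hL]
      _ = μ * (apdaParams M μ L χ lmax).etaX * √(L / μ) ^ 2 := by ring
      _ = _ := by rw [mul_etaX_eq M lmax hμ]; field_simp
  rw [mul_add, mul_one_div_cancel h3.ne', e]
  nlinarith

/-- The three possible rates are at least of order `1/√κ`, because `λ₂ / λ₁ ≥ 1/16`. The constant
`512` comes from the second branch of `β_y`, where the rate is `(λ₂ / λ₁)² / 2 ≥ 1/512`. -/
theorem theta_le (hμ : 0 < μ) (hμL : μ ≤ L) (hχ : 1 ≤ χ) :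
    (apdaParams M μ L χ lmax).theta ≤ 1 - 1 / (512 * √(L / μ)) := by
  have h1 := one_le_sqrt_div hμ hμL
  have h2 := mul_etaX_le M lmax hμ hμL hχ
  have h3 := mul_etaX_ge M lmax hμ hμL hχ
  have hex := etaX_pos M lmax hμ hμL hχ
  have hey := etaY_pos M lmax hμ hμL hχ
  have hq := lambda_ratio_ge hχ
  have hl1 := one_le_lambda₁ hχ
  have hl2 := lambda₂_pos hχ
  have hLs := eq_mul_sqrt_div_sq hμ (hμ.le.trans hμL)
  have hL : 0 < L := hμ.trans_le hμL
  set s := √(L / μ) with hs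
  have hs0 : 0 < s := by linarith
  have e512 : 1 / (512 * s) = 1 / 16 * (1 / (32 * s)) := by field_simp; norm_num
  refine max_le ?_ ?_
  · change 2 / (2 + μ * (apdaParams M μ L χ lmax).etaX) ≤ 1 - 1 / (512 * s)
    set a := μ * (apdaParams M μ L χ lmax).etaX
    have ha : 0 < a := by positivity
    rw [div_le_iff₀ (by positivity), e512]
    have : 0 < 1 / (32 * s) := by positivity
    nlinarith
  · change 1 - lambda₂ χ ^ 2 * min (1 / L) (1 / (2 * lambda₁ χ ^ 2 *
      (apdaParams M μ L χ lmax).etaY)) * (apdaParams M μ L χ lmax).etaY ≤ 1 - 1 / (512 * s)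
    have key : 1 / (512 * s) ≤ lambda₂ χ ^ 2 * min (1 / L) (1 / (2 * lambda₁ χ ^ 2 *
        (apdaParams M μ L χ lmax).etaY)) * (apdaParams M μ L χ lmax).etaY := by
      rcases min_choice (1 / L) (1 / (2 * lambda₁ χ ^ 2 * (apdaParams M μ L χ lmax).etaY))
        with h | h
      · rw [h, etaY_eq M lmax hμ, ← hs]
        have h4 : √2 ≤ 2 := Real.sqrt_le_iff.2 ⟨by norm_num, by norm_num⟩
        have e1 : lambda₂ χ ^ 2 * (1 / L) * (μ * s / (√2 * lambda₁ χ * lambda₂ χ))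
            = lambda₂ χ / lambda₁ χ / (√2 * s) := by
          rw [hLs]; field_simp
        rw [e1, div_le_div_iff₀ (by positivity) (by positivity)]
        have h5 : √2 * s ≤ 2 * s := by gcongr
        nlinarith
      · rw [h]
        have e1 : lambda₂ χ ^ 2 * (1 / (2 * lambda₁ χ ^ 2 * (apdaParams M μ L χ lmax).etaY))
            * (apdaParams M μ L χ lmax).etaY = (lambda₂ χ / lambda₁ χ) ^ 2 / 2 := by
          field_simp
        rw [e1]
        have h5 : 1 / (512 * s) ≤ 1 / 512 := by
          apply one_div_le_one_div_of_le <;> linarith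
        nlinarith
    linarith

theorem theta_ge : 2 / (2 + μ * (apdaParams M μ L χ lmax).etaX)
    ≤ (apdaParams M μ L χ lmax).theta := le_max_left _ _

theorem theta_ge' : 1 - lambda₂ χ ^ 2 * (apdaParams M μ L χ lmax).betaY
    * (apdaParams M μ L χ lmax).etaY ≤ (apdaParams M μ L χ lmax).theta := le_max_right _ _

theorem theta_pos (hμ : 0 < μ) (hμL : μ ≤ L) (hχ : 1 ≤ χ) :
    0 < (apdaParams M μ L χ lmax).theta := by
  have h1 := etaX_pos M lmax hμ hμL hχ
  exact lt_of_lt_of_le (by positivity) (theta_ge M lmax)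

theorem InnerMethod.const_pos (M : InnerMethod) : 0 < M.const := by
  cases M <;> norm_num [InnerMethod.const]

theorem T_pow_ge (hμ : 0 < μ) (hμL : μ ≤ L) :
    20 * M.const * (1 + √(L / μ)) ^ 2 ≤ ((apdaParams M μ L χ lmax).T : ℝ) ^ M.alphaNat := by
  have h1 := one_le_sqrt_div hμ hμL
  have hA := M.const_pos
  have hn : (M.alphaNat : ℝ) ≠ 0 := by cases M <;> norm_num [InnerMethod.alphaNat]
  have hT : (20 * M.const) ^ (1 / M.alpha) * (1 + √(L / μ)) ^ (2 / M.alpha)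
    ≤ ((apdaParams M μ L χ lmax).T : ℝ) := Nat.le_ceil _
  refine le_trans (le_of_eq ?_) (pow_le_pow_left₀ (by positivity) hT _)
  rw [mul_pow, ← Real.rpow_natCast (_ ^ (1 / M.alpha)), ← Real.rpow_natCast (_ ^ (2 / M.alpha)),
    ← Real.rpow_mul (by positivity), ← Real.rpow_mul (by positivity), M.alpha_eq,
    div_mul_cancel₀ _ hn, div_mul_cancel₀ _ hn, Real.rpow_one, Real.rpow_two]

theorem two_le_T (hμ : 0 < μ) (hμL : μ ≤ L) : 2 ≤ (apdaParams M μ L χ lmax).T := by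
  have h1 := one_le_sqrt_div hμ hμL
  have h2 := T_pow_ge M (χ := χ) lmax hμ hμL
  by_contra! hlt
  have hT : ((apdaParams M μ L χ lmax).T : ℝ) ≤ 1 := by
    exact_mod_cast Nat.le_of_lt_succ hlt
  have h3 := pow_le_one₀ (n := M.alphaNat) (Nat.cast_nonneg _) hT
  have hA : 4 ≤ M.const := by cases M <;> norm_num [InnerMethod.const]
  nlinarith

/-- Since `α ≥ 2`, the factors are at most `20 · 256 = 5120` and `2 κ^{1/α}`; the ceiling adds one,
whence `2 · 5120 + 1`. -/
theorem T_le (hμ : 0 < μ) (hμL : μ ≤ L) :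
    ((apdaParams M μ L χ lmax).T : ℝ) ≤ 10241 * (L / μ) ^ (1 / M.alpha) := by
  have h1 := one_le_sqrt_div hμ hμL
  have hκ : 1 ≤ L / μ := (one_le_div hμ).2 hμL
  have ha : 2 ≤ M.alpha := by cases M <;> norm_num [InnerMethod.alpha]
  have hA : 1 ≤ 20 * M.const := by cases M <;> norm_num [InnerMethod.const]
  have hA' : 20 * M.const ≤ 5120 := by cases M <;> norm_num [InnerMethod.const]
  have hT : ((apdaParams M μ L χ lmax).T : ℝ)
      < (20 * M.const) ^ (1 / M.alpha) * (1 + √(L / μ)) ^ (2 / M.alpha) + 1 :=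
    Nat.ceil_lt_add_one (by positivity)
  have e1 : (20 * M.const) ^ (1 / M.alpha) ≤ 5120 := by
    refine le_trans (Real.rpow_le_rpow_of_exponent_le hA ?_) ((Real.rpow_one _).le.trans hA')
    rw [div_le_one (by linarith)]; linarith
  have e2 : (1 + √(L / μ)) ^ (2 / M.alpha) ≤ 2 * (L / μ) ^ (1 / M.alpha) := by
    calc (1 + √(L / μ)) ^ (2 / M.alpha) ≤ (2 * √(L / μ)) ^ (2 / M.alpha) := by
          gcongr; linarith
      _ = 2 ^ (2 / M.alpha) * (L / μ) ^ (1 / M.alpha) := by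
          rw [Real.mul_rpow (by norm_num) (by positivity), Real.sqrt_eq_rpow,
            ← Real.rpow_mul (by positivity)]
          congr 2
          ring
      _ ≤ 2 * (L / μ) ^ (1 / M.alpha) := by
          refine mul_le_mul_of_nonneg_right ?_ (by positivity)
          refine le_trans (Real.rpow_le_rpow_of_exponent_le (by norm_num)
            ((div_le_one (by linarith)).2 ha)) (Real.rpow_one _).le
  have e3 : 1 ≤ (L / μ) ^ (1 / M.alpha) := Real.one_le_rpow hκ (by positivity)
  have e4 : (20 * M.const) ^ (1 / M.alpha) * (1 + √(L / μ)) ^ (2 / M.alpha)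
      ≤ 5120 * (2 * (L / μ) ^ (1 / M.alpha)) := by gcongr
  linarith

end Parameters

/-! ### One iteration of the algorithm -/

section Iteration

variable {n d : ℕ}

/-- The gradient oracle of `Ψᵏ`. -/
noncomputable def auxGrad (P : Vec n d → ℝ) (W : Matrix (Fin n × Fin d) (Fin n × Fin d) ℝ)
    (p : Params) (s : State n d) : Vec n d → Counted (Vec n d) := fun z => do
  let v ← gradOracle P z
  pure (v + (1 / p.etaX) • (z - (s.x - p.etaX • gossipMap W p s.ybar)))

variable (M : InnerMethod) (L : ℝ) (P : Vec n d → ℝ)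
  (W : Matrix (Fin n × Fin d) (Fin n × Fin d) ℝ) (p : Params) (s : State n d)

theorem apdaStep_xhat : (apdaStep M L P W p s).val.xhat
    = (M.run (auxGrad P W p s) (L + 1 / p.etaX) s.x p.T).val := rfl

theorem apdaStep_x : (apdaStep M L P W p s).val.x = s.x - p.etaX •
    (gradient P (apdaStep M L P W p s).val.xhat + gossipMap W p s.ybar) := rfl

theorem apdaStep_y : (apdaStep M L P W p s).val.y = s.y + p.etaY •
    (gossipMap W p (apdaStep M L P W p s).val.xhat - p.betaY • gossipMap W p
      (gossipMap W p s.y + gradient P (apdaStep M L P W p s).val.xhat)) := rfl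

theorem apdaStep_ybar : (apdaStep M L P W p s).val.ybar = (apdaStep M L P W p s).val.y +
    p.theta • ((apdaStep M L P W p s).val.y - s.y) := rfl

variable {L P}

/-- The accuracy of the approximate prox. -/
theorem prox_accuracy {μ : ℝ} (hμ : 0 < μ) (hμL : μ ≤ L) (hP : Differentiable ℝ P)
    (hconv : IsStronglyConvex μ P) (hsm : IsLSmooth L P) {h q : ℝ} (hh : p.etaX = h) (hh0 : 0 < h)
    (hhL : h * (L + 1 / h) ≤ 3 / 4 * q) (hT2 : 2 ≤ p.T)
    (hT : 20 * M.const * q ^ 2 ≤ (p.T : ℝ) ^ M.alphaNat) :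
    ‖(apdaStep M L P W p s).val.x - (apdaStep M L P W p s).val.xhat‖ ^ 2
        ≤ ‖s.x - auxMinimizer P W p s‖ ^ 2 / 64 ∧
      ‖(apdaStep M L P W p s).val.xhat - auxMinimizer P W p s‖ ^ 2
        ≤ ‖s.x - auxMinimizer P W p s‖ ^ 2 / 64 := by
  have hL : 0 < L := hμ.trans_le hμL
  have hc := hconv.convex hμ
  have hs := descent_of_isLSmooth hP hsm
  set c := s.x - p.etaX • gossipMap W p s.ybar with hcdef
  have hΨ := smoothConvex_add_prox hc hs hL hh0 c
  have hw : ∀ z, auxObjective P W p s (auxMinimizer P W p s) ≤ auxObjective P W p s z := by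
    refine Classical.epsilon_spec (p := fun w => ∀ z, auxObjective P W p s w
      ≤ auxObjective P W p s z) ?_
    unfold auxObjective
    rw [hh]
    have := exists_prox_minimizer hc hP.continuous hh0 c
    rwa [hcdef, hh] at this
  set w := auxMinimizer P W p s with hwdef
  have hℓ : 0 < L + 1 / h := by positivity
  have hg0 := hΨ.grad_eq_zero hℓ (w := w) (by
    intro z
    have := hw z
    unfold auxObjective at this
    rw [← hcdef, hh] at this
    exact this)
  have hval : ∀ z, (auxGrad P W p s z).val = gradient P z + (1 / h) • (z - c) := by
    intro z
    rw [← hh]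
    rfl
  have hrun := M.run_bound (g := auxGrad P W p s) (L := L + 1 / h)
    (f := fun z => P z + 1 / (2 * h) * ‖z - c‖ ^ 2) (xs := w)
    (by simp only [hval]; exact hΨ) hℓ (by rw [hval]; exact hg0) s.x hT2
  rw [← hh, ← apdaStep_xhat, hval, hh] at hrun
  set xh := (apdaStep M L P W p s).val.xhat with hxh
  set G := gradient P xh + (1 / h) • (xh - c) with hG
  have hA := M.const_pos
  -- The factor `20` in `T` is used here: `(1/2)(3/4)² = 9/32`, which is below `20/64`.
  have hbound : (h * ‖G‖) ^ 2 ≤ ‖s.x - w‖ ^ 2 / 64 := by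
    have hq : 0 < q := by
      have : 0 < h * (L + 1 / h) := by positivity
      linarith
    have h1 : (h * (L + 1 / h)) ^ 2 ≤ (3 / 4 * q) ^ 2 := pow_le_pow_left₀ (by positivity) hhL 2
    have h2 : 20 * M.const * q ^ 2 * (h * ‖G‖) ^ 2
        ≤ 20 * M.const * q ^ 2 * (‖s.x - w‖ ^ 2 / 64) := by
      calc 20 * M.const * q ^ 2 * (h * ‖G‖) ^ 2
          ≤ (p.T : ℝ) ^ M.alphaNat * (h * ‖G‖) ^ 2 := by gcongr
        _ = h ^ 2 * ((p.T : ℝ) ^ M.alphaNat * ‖G‖ ^ 2) := by ring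
        _ ≤ h ^ 2 * (M.const / 2 * (L + 1 / h) ^ 2 * ‖s.x - w‖ ^ 2) := by gcongr
        _ = M.const / 2 * (h * (L + 1 / h)) ^ 2 * ‖s.x - w‖ ^ 2 := by ring
        _ ≤ M.const / 2 * (3 / 4 * q) ^ 2 * ‖s.x - w‖ ^ 2 := by gcongr
        _ = 9 / 32 * (M.const * q ^ 2 * ‖s.x - w‖ ^ 2) := by ring
        _ ≤ 20 / 64 * (M.const * q ^ 2 * ‖s.x - w‖ ^ 2) :=
            mul_le_mul_of_nonneg_right (by norm_num) (by positivity)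
        _ = _ := by ring
    exact le_of_mul_le_mul_left h2 (by positivity)
  constructor
  -- The primal update is one gradient step on `Ψᵏ` from the approximate prox, with step size `h`.
  · have e : (apdaStep M L P W p s).val.x - xh = -(h • G) := by
      have e1 : h • (1 / h) • (xh - c) = xh - c := by
        rw [smul_smul, mul_one_div_cancel hh0.ne', one_smul]
      rw [hG, smul_add, e1, apdaStep_x, ← hxh, hcdef, hh, smul_add]
      abel
    rwa [e, norm_neg, norm_smul, Real.norm_eq_abs, abs_of_pos hh0]
  -- The quadratic term makes the gradient of `Ψᵏ` strongly monotone with constant `1 / h`, so `‖xh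
  -- - w‖ ≤ h‖G‖`.
  · refine le_trans (pow_le_pow_left₀ (norm_nonneg _) ?_ 2) hbound
    have h1 := hconv.le_inner xh w
    have h2 : G = (gradient P xh - gradient P w) + (1 / h) • (xh - w) := by
      have : gradient P w = -((1 / h) • (w - c)) := eq_neg_of_add_eq_zero_left hg0
      rw [hG, this]
      module
    have h3 := real_inner_le_norm G (xh - w)
    have h4 : inner ℝ G (xh - w) = inner ℝ (gradient P xh - gradient P w) (xh - w)
        + 1 / h * ‖xh - w‖ ^ 2 := by
      rw [h2, inner_add_left, real_inner_smul_left, real_inner_self_eq_norm_sq]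
    have h5 : 0 ≤ μ * ‖xh - w‖ ^ 2 := by positivity
    have h6 : 1 / h * ‖xh - w‖ ^ 2 ≤ ‖G‖ * ‖xh - w‖ := by linarith
    rcases (norm_nonneg (xh - w)).eq_or_lt with h0 | h0
    · rw [← h0]; positivity
    · have h7 : 1 / h * ‖xh - w‖ ≤ ‖G‖ := by
        refine le_of_mul_le_mul_right (le_trans (le_of_eq ?_) h6) h0
        ring
      rw [one_div, inv_mul_le_iff₀ hh0] at h7
      exact h7

end Iteration

/-! ### Linear convergence and complexity -/

section Convergence

variable {n d : ℕ} {W : Matrix (Fin n × Fin d) (Fin n × Fin d) ℝ}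

/-- Testing the maximum at `ys + K xs` forces `K xs = 0`; the minimum condition says that `xs`
minimizes `P` plus the linear term `⟨K ys, ·⟩`. -/
theorem gradient_add_eq_zero_of_isSaddlePoint {P : Vec n d → ℝ} {μ L : ℝ} (hμ : 0 < μ)
    (hL : 0 < L) (hP : Differentiable ℝ P) (hconv : IsStronglyConvex μ P) (hsm : IsLSmooth L P)
    (K : Vec n d →ₗ[ℝ] Vec n d) (hsymm : ∀ x y, inner ℝ (K x) y = inner ℝ x (K y))
    {xs ys : Vec n d} (h : IsSaddlePoint P K xs ys) :
    K xs = 0 ∧ gradient P xs + K ys = 0 := by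
  obtain ⟨h1, h2⟩ := h
  constructor
  · have h3 := h1 (ys + K xs)
    rw [inner_add_left, real_inner_self_eq_norm_sq] at h3
    have h4 : ‖K xs‖ ^ 2 = 0 := le_antisymm (by linarith) (sq_nonneg _)
    exact norm_eq_zero.1 (pow_eq_zero_iff two_ne_zero |>.1 h4)
  · have hsc := smoothConvex_of_bounds hL (hconv.convex hμ) (descent_of_isLSmooth hP hsm)
    refine (hsc.add_linear (K ys)).grad_eq_zero hL (w := xs) fun z => ?_
    have := h2 z
    rwa [← hsymm, ← hsymm] at this

/-- Nonnegativity and linear decrease of the Lyapunov function. -/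
theorem lyapunov_bounds (hW : W.PosSemidef) (hW0 : W ≠ 0) {P : Vec n d → ℝ} {μ L : ℝ}
    (hμ : 0 < μ) (hμL : μ ≤ L) (hP : Differentiable ℝ P) (hconv : IsStronglyConvex μ P)
    (hsm : IsLSmooth L P) (M : InnerMethod) (x₀ y₀ : Vec n d) {xs ys : Vec n d}
    (hsaddle : IsSaddlePoint P (gossipMap W (apdaParams M μ L (chi W) (lambdaMax W))) xs ys)
    (hys : ys - y₀ ∈ LinearMap.range (Matrix.toEuclideanLin W)) (k : ℕ) :
    0 ≤ lyapunov M μ L P W (apdaParams M μ L (chi W) (lambdaMax W)) x₀ y₀ xs ys k ∧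
      lyapunov M μ L P W (apdaParams M μ L (chi W) (lambdaMax W)) x₀ y₀ xs ys k
        ≤ (apdaParams M μ L (chi W) (lambdaMax W)).theta ^ k
          * lyapunov M μ L P W (apdaParams M μ L (chi W) (lambdaMax W)) x₀ y₀ xs ys 0 := by
  have hL : 0 < L := hμ.trans_le hμL
  have hχ := one_le_chi hW hW0
  obtain ⟨K, S, hgK, hsymm, hK1, hK2, hKS, hrange⟩ := exists_gossip_linearMap hW hW0 M μ L
  have hex := etaX_pos M (lambdaMax W) hμ hμL hχ
  have hey := etaY_pos M (lambdaMax W) hμ hμL hχ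
  have hb := betaY_nonneg M (lambdaMax W) hμ hμL hχ
  have hbe := betaY_mul_le M (lambdaMax W) hμ hμL hχ
  have hhe := etaY_mul_le M (lambdaMax W) hμ hμL hχ
  have hμh := mul_etaX_le M (lambdaMax W) hμ hμL hχ
  have hhL := etaX_mul_smooth_le M (lambdaMax W) hμ hμL hχ
  have hθ := theta_ge M (μ := μ) (L := L) (χ := chi W) (lambdaMax W)
  have hθ' := theta_ge' M (μ := μ) (L := L) (χ := chi W) (lambdaMax W)
  have hθ0 := theta_pos M (lambdaMax W) hμ hμL hχ
  have hθ1 : (apdaParams M μ L (chi W) (lambdaMax W)).theta ≤ 1 := by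
    have h1 := theta_le M (lambdaMax W) hμ hμL hχ
    have h2 : 0 ≤ 1 / (512 * √(L / μ)) := by positivity
    linarith
  have hT2 := two_le_T M (χ := chi W) (lambdaMax W) hμ hμL
  have hT := T_pow_ge M (χ := chi W) (lambdaMax W) hμ hμL
  have hbL : (apdaParams M μ L (chi W) (lambdaMax W)).betaY ≤ 1 / L := min_le_left _ _
  set p := apdaParams M μ L (chi W) (lambdaMax W) with hp
  rw [hgK] at hsaddle
  obtain ⟨hxs, hgs⟩ := gradient_add_eq_zero_of_isSaddlePoint hμ hL hP hconv hsm K hsymm hsaddle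
  have hsc := smoothConvex_of_bounds hL (hconv.convex hμ) (descent_of_isLSmooth hP hsm)
  set Δ := lyapunov M μ L P W p x₀ y₀ xs ys with hΔ
  let st : ℕ → State n d := fun k => (apda M L P W p x₀ y₀ k).val
  have hst : ∀ k, st (k + 1) = (apdaStep M L P W p (st k)).val := fun k => rfl
  -- Hiding the previous dual iterate and the previous prox distance behind `yp` and `D` lets the
  -- two clauses of the Lyapunov function be treated alike. At `k = 0` the witnesses `y₀` and `0`
  -- kill the extra terms.
  have inv : ∀ k, (∃ (yp : Vec n d) (D : ℝ),
      ‖(st k).x - (st k).xhat‖ ^ 2 ≤ D / 64 ∧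
      (st k).ybar = (st k).y + p.theta • ((st k).y - yp) ∧
      (st k).y - ys ∈ S ∧
      Δ k = lyapunovValue K μ p.etaX p.etaY xs ys (st k).x (st k).y yp (st k).xhat D) ∧
      Δ k ≤ p.theta ^ k * Δ 0 := by
    intro k
    induction k with
    | zero =>
      refine ⟨⟨y₀, 0, ?_, ?_, ?_, ?_⟩, ?_⟩
      · simp [st, apda, pure]
      · simp [st, apda, pure]
      · have h1 := S.neg_mem (hrange hys)
        rwa [neg_sub] at h1
      · simp [hΔ, lyapunov, lyapunovValue, st, apda, pure]
      · simp
    | succ k ih =>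
      obtain ⟨⟨yp, D, hD, hybar, hyS, hΔk⟩, hdec⟩ := ih
      set s := st k with hs
      have hacc := prox_accuracy M W p s hμ hμL hP hconv hsm (q := 1 + √(L / μ)) rfl hex hhL hT2 hT
      rw [← hst] at hacc
      have hx' := apdaStep_x M L P W p s
      have hy' := apdaStep_y M L P W p s
      have hyb' := apdaStep_ybar M L P W p s
      rw [← hst] at hx' hy' hyb'
      set s' := st (k + 1) with hs'
      set w := auxMinimizer P W p s with hw
      rw [hgK] at hx' hy'
      have hΔ' : Δ (k + 1) = lyapunovValue K μ p.etaX p.etaY xs ys s'.x s'.y s.y s'.xhat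
          (‖s.x - w‖ ^ 2) := by
        have : Δ (k + 1) = (1 + μ * p.etaX / 2) * (1 / p.etaX) * ‖s'.x - xs‖ ^ 2
          + 1 / p.etaY * ‖s'.y - ys‖ ^ 2 + 1 / (2 * p.etaY) * ‖s'.y - s.y‖ ^ 2
          + 1 / (8 * p.etaX) * ‖s.x - auxMinimizer P W p s‖ ^ 2
          - 2 * inner ℝ (gossipMap W p s'.y - gossipMap W p s.y) (s'.xhat - xs) := rfl
        rw [this, hgK]
        rfl
      refine ⟨⟨s.y, ‖s.x - w‖ ^ 2, hacc.1, hyb', ?_, hΔ'⟩, ?_⟩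
      · have e : s'.y - ys = (s.y - ys) + p.etaY • K (s'.xhat
            - p.betaY • (K s.y + gradient P s'.xhat)) := by
          rw [hy', map_sub, map_smul]; abel
        rw [e]
        exact S.add_mem hyS (S.smul_mem _ (hKS _))
      · have hstep := lyapunovValue_step K hsymm hμ hex hey hb (lambda₂_pos hχ).le hK1 hbL hbe hhe
          hμh hθ hθ' hθ1 hxs hgs (hconv.le_inner s'.xhat xs) (hsc.le_inner s'.xhat xs)
          (hK2 _ hyS) hybar hx' hy' hD hacc.1 hacc.2
        rw [← hΔ', ← hΔk] at hstep
        calc Δ (k + 1) ≤ p.theta * Δ k := hstep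
          _ ≤ p.theta * (p.theta ^ k * Δ 0) := by gcongr
          _ = _ := by ring
  obtain ⟨⟨yp, D, hD, -, -, hΔk⟩, hdec⟩ := inv k
  refine ⟨?_, hdec⟩
  rw [hΔk]
  exact lyapunovValue_nonneg K hμ hex hey hK1 hhe xs ys hD

end Convergence

/-! ### Iteration count and total complexity -/

theorem pow_le_of_le_one_sub {θ ε s : ℝ} (hθ : 0 ≤ θ) (hs : 0 < s) (hθs : θ ≤ 1 - 1 / s)
    (hε : 0 < ε) {k : ℕ} (hk : s * Real.log (1 / ε) ≤ k) : θ ^ k ≤ ε := by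
  calc θ ^ k ≤ (Real.exp (-(1 / s))) ^ k := by
        gcongr
        have := Real.add_one_le_exp (-(1 / s))
        linarith
    _ = Real.exp (-(k / s)) := by rw [← Real.exp_nat_mul]; ring_nf
    _ ≤ Real.exp (Real.log ε) := by
        apply Real.exp_le_exp.2
        rw [one_div, Real.log_inv] at hk
        have : -Real.log ε ≤ k / s := by rw [le_div_iff₀ hs]; linarith
        linarith
    _ = ε := Real.exp_log hε

end Decentralized

open Decentralized in
theorem mainTheorem3 :
    ∃ C : ℝ, 0 < C ∧
      ∀ (n d : ℕ) (_ : 0 < d) (G : SimpleGraph (Fin n)) (_ : G.Connected)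
        (What : Matrix (Fin n) (Fin n) ℝ) (_ : IsGossipMatrix G What)
        (f : Fin n → EuclideanSpace ℝ (Fin d) → ℝ) (_ : ∀ i, Differentiable ℝ (f i))
        (μ L : ℝ) (_ : 0 < μ)
        (_ : IsStronglyConvex μ (stackedObjective f)) (_ : IsLSmooth L (stackedObjective f))
        (M : InnerMethod) (x₀ y₀ xs ys : Vec n d),
        let P : Vec n d → ℝ := stackedObjective f
        let W := stackedGossip d What
        let χ : ℝ := chi W
        let κ : ℝ := L / μ
        let p : Params := apdaParams M μ L χ (lambdaMax W)
        let Δ : ℕ → ℝ := lyapunov M μ L P W p x₀ y₀ xs ys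
        IsSaddlePoint P (gossipMap W p) xs ys →
        ys - y₀ ∈ LinearMap.range (Matrix.toEuclideanLin W) →
          (∀ k : ℕ, 0 ≤ Δ k ∧ Δ k ≤ p.theta ^ k * Δ 0) ∧
          (p.T : ℝ) ≤ C * κ ^ (1 / M.alpha) ∧
          ∀ ε : ℝ, 0 < ε → ∃ k : ℕ, Δ k ≤ ε * Δ 0 ∧
            ((apda M L P W p x₀ y₀ k).grads : ℝ) ≤
              C * κ ^ ((2 + M.alpha) / (2 * M.alpha)) * max 1 (Real.log (1 / ε)) ∧
            ((apda M L P W p x₀ y₀ k).comms : ℝ) ≤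
              C * √(κ * χ) * max 1 (Real.log (1 / ε)) := by
  -- The gradient count is decisive: it needs `513 · 10242`, about `5.3 · 10⁶`.
  refine ⟨10 ^ 7, by norm_num, ?_⟩
  intro n d hd G hG What hWhat f hf μ L hμ hconv hsm M x₀ y₀ xs ys P W χ κ p Δ hsaddle hys
  have hW : W.PosSemidef := stackedGossip_posSemidef d hWhat
  have hW0 : W ≠ 0 := stackedGossip_ne_zero hd hG hWhat
  have hP : Differentiable ℝ P := differentiable_stackedObjective hf
  have hχ : 1 ≤ χ := one_le_chi hW hW0
  have hμL : μ ≤ L := by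
    obtain ⟨i⟩ := hG.nonempty
    refine hconv.le_of_isLSmooth hsm (x := EuclideanSpace.single (i, ⟨0, hd⟩) 1) (y := 0) ?_
    intro h
    have := congrArg norm h
    simp at this
  have hκ : 1 ≤ κ := (one_le_div hμ).2 hμL
  have hbounds : ∀ k : ℕ, 0 ≤ Δ k ∧ Δ k ≤ p.theta ^ k * Δ 0 := fun k =>
    lyapunov_bounds hW hW0 hμ hμL hP hconv hsm M x₀ y₀ hsaddle hys k
  have hT : (p.T : ℝ) ≤ 10241 * κ ^ (1 / M.alpha) := T_le M (lambdaMax W) hμ hμL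
  have hα : 0 < M.alpha := by cases M <;> norm_num [InnerMethod.alpha]
  have hκα : 1 ≤ κ ^ (1 / M.alpha) := Real.one_le_rpow hκ (by positivity)
  refine ⟨hbounds, hT.trans (by gcongr; norm_num), fun ε hε => ?_⟩
  have hθ0 : 0 < p.theta := theta_pos M (lambdaMax W) hμ hμL hχ
  -- For `ε ≥ 1` zero iterations suffice; otherwise the logarithm is nonnegative.
  rcases le_or_gt 1 ε with h1 | h1
  · refine ⟨0, le_mul_of_one_le_left (hbounds 0).1 h1, ?_, ?_⟩
    · rw [apda_grads]
      simp only [zero_mul, Nat.cast_zero]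
      positivity
    · rw [apda_comms]
      simp only [zero_mul, Nat.cast_zero]
      positivity
  have hlog : 0 ≤ Real.log (1 / ε) := Real.log_nonneg ((one_le_div hε).2 h1.le)
  set R := max 1 (Real.log (1 / ε)) with hR
  have hR1 : 1 ≤ R := le_max_left _ _
  have hs : 1 ≤ √κ := Real.one_le_sqrt.2 hκ
  set k := ⌈512 * √κ * Real.log (1 / ε)⌉₊ with hk
  -- The `+1` of the ceiling is absorbed by `√κ * R ≥ 1`, turning `512` into `513`.
  have hkR : (k : ℝ) ≤ 513 * √κ * R := by
    have h2 : (k : ℝ) < 512 * √κ * Real.log (1 / ε) + 1 := Nat.ceil_lt_add_one (by positivity)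
    have h3 : 512 * √κ * Real.log (1 / ε) ≤ 512 * √κ * R := by
      gcongr; exact le_max_right _ _
    nlinarith
  refine ⟨k, (hbounds k).2.trans ?_, ?_, ?_⟩
  · refine mul_le_mul_of_nonneg_right ?_ (hbounds 0).1
    exact pow_le_of_le_one_sub hθ0.le (by positivity) (theta_le M (lambdaMax W) hμ hμL hχ) hε
      (Nat.le_ceil _)
  · rw [apda_grads]
    push_cast
    have e : κ ^ ((2 + M.alpha) / (2 * M.alpha)) = √κ * κ ^ (1 / M.alpha) := by
      rw [Real.sqrt_eq_rpow, ← Real.rpow_add (by linarith)]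
      congr 1
      field_simp
      ring
    rw [e]
    calc (k : ℝ) * (p.T + 1) ≤ 513 * √κ * R * (10241 * κ ^ (1 / M.alpha) + κ ^ (1 / M.alpha)) := by
          gcongr
      _ = 513 * 10242 * (√κ * κ ^ (1 / M.alpha) * R) := by ring
      _ ≤ 10 ^ 7 * (√κ * κ ^ (1 / M.alpha) * R) := by gcongr; norm_num
      _ = _ := by ring
  · rw [apda_comms]
    push_cast
    have hN : (p.N : ℝ) ≤ √χ := gossipSteps_le
    rw [Real.sqrt_mul (by linarith)]
    calc (k : ℝ) * (4 * p.N) ≤ 513 * √κ * R * (4 * √χ) := by gcongr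
      _ = 2052 * (√κ * √χ * R) := by ring
      _ ≤ 10 ^ 7 * (√κ * √χ * R) := by gcongr; norm_num
      _ = _ := by ring
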